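/- Let $n\ge 0$ be an integer and let $L(M_2,M_n)$ be the space of complex linear maps from $M_2$ to $M_n$ (complex matrices). A map $\varphi\in L(M_2,M_n)$ is completely copositive if $X\mapsto \varphi(X^{\mathsf t})$ is completely positive. Let $\mathbb D\subset L(M_2,M_n)$ be the convex cone of decomposable maps, i.e. of all sums of a completely positive map and a completely copositive map. For a complex linear subspace $D$ of the space $M_{2\times n}$ of complex $2\times n$ matrices put $$\Phi_D=\Big\{\sum_{V\in\mathcal V}\phi_V:\ \mathcal V\subset D \text{ finite}\Big\},\qquad \phi_V(X)=V^*XV .$$ Suppose that $\Phi_D$ is a face of $\mathbb D$, i.e. $\Phi_D$ is a convex subset of $\mathbb D$ such that, whenever a point of $\Phi_D$ lies in the open segment between two points of $\mathbb D$, both of these points lie in $\Phi_D$. Then the following are equivalent: (a) $\Phi_D$ is exposed: there is a real linear functional $f:L(M_2,M_n)\to\mathbb R$ with $f\ge 0$ on $\mathbb D$ and $\Phi_D=\{\varphi\in\mathbb D: f(\varphi)=0\}$; (b) $\Phi_D$ is exposed by separable states: there is $A=\sum_{s} y_s\otimes x_s$ (a finite sum) with $y_s\in M_n$ and $x_s\in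 M_2$ positive semidefinite, such that $\Phi_D=\{\varphi\in\mathbb D:\langle A,\varphi\rangle=0\}$, where $\langle\cdot,\cdot\rangle$ is the bilinear pairing between $M_n\otimes M_2$ and $L(M_2,M_n)$ determined by $\langle y\otimes x,\varphi\rangle=\operatorname{Tr}(\varphi(x)\,y^{\mathsf t})$. -/

import Mathlib

open scoped Kronecker ComplexOrder

/-- The space `L(M_m, M_n)` of all complex linear maps from `M_m` into `M_n`. -/
abbrev MatrixMap (m n : ℕ) : Type :=
  Matrix (Fin m) (Fin m) ℂ →ₗ[ℂ] Matrix (Fin n) (Fin n) ℂ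

/-- The ampliation `id_k ⊗ φ : M_k(M_m) → M_k(M_n)`, which applies `φ` to every block. -/
def blockwiseMap {m n : ℕ} (k : ℕ) (φ : MatrixMap m n)
    (X : Matrix (Fin k × Fin m) (Fin k × Fin m) ℂ) :
    Matrix (Fin k × Fin n) (Fin k × Fin n) ℂ :=
  Matrix.of fun p q => φ (Matrix.of fun i j => X (p.1, i) (q.1, j)) p.2 q.2

/-- `φ` is completely positive: every ampliation preserves positive semidefiniteness. -/
def IsCompletelyPositive {m n : ℕ} (φ : MatrixMap m n) : Prop :=
  ∀ (k : ℕ) (X : Matrix (Fin k × Fin m) (Fin k × Fin m) ℂ),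
    X.PosSemidef → (blockwiseMap k φ X).PosSemidef

/-- The transposition `X ↦ Xᵀ` on `M_m`. -/
def transposition (m : ℕ) : MatrixMap m m :=
  (Matrix.transposeLinearEquiv (Fin m) (Fin m) ℂ ℂ).toLinearMap

/-- `φ` is completely copositive: `X ↦ φ (Xᵀ)` is completely positive. -/
def IsCompletelyCopositive {m n : ℕ} (φ : MatrixMap m n) : Prop :=
  IsCompletelyPositive (φ ∘ₗ transposition m)

/-- The cone `𝔻` of decomposable maps: sums of a completely positive map and a completely
copositive map. -/
def decomposableCone (m n : ℕ) : Set (MatrixMap m n) :=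
  {φ | ∃ ψ χ : MatrixMap m n,
    IsCompletelyPositive ψ ∧ IsCompletelyCopositive χ ∧ φ = ψ + χ}

/-- The elementary completely positive map `φ_V : X ↦ V* X V`. -/
def elementaryMap {m n : ℕ} (V : Matrix (Fin m) (Fin n) ℂ) : MatrixMap m n where
  toFun X := V.conjTranspose * X * V
  map_add' X Y := by rw [Matrix.mul_add, Matrix.add_mul]
  map_smul' c X := by rw [Matrix.mul_smul, Matrix.smul_mul, RingHom.id_apply]

/-- `Φ_D`: the set of all finite sums `∑_{V ∈ 𝒱} φ_V` with `𝒱 ⊆ D`. -/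
def cpFace {m n : ℕ} (D : Submodule ℂ (Matrix (Fin m) (Fin n) ℂ)) : Set (MatrixMap m n) :=
  {φ | ∃ 𝒱 : Finset (Matrix (Fin m) (Fin n) ℂ),
    (𝒱 : Set (Matrix (Fin m) (Fin n) ℂ)) ⊆ D ∧ φ = ∑ V ∈ 𝒱, elementaryMap V}

/-- `F` is a face of the convex set `C`: a convex extreme subset. -/
def IsConvexFace {W : Type*} [AddCommGroup W] [Module ℝ W] (C F : Set W) : Prop :=
  Convex ℝ F ∧ IsExtreme ℝ C F

/-- The set `F` is cut out of the convex cone `C` by a real linear functional that is nonnegative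
on `C` (for a face `F` of `C` in finite dimension: `F` is exposed). -/
def IsExposedInCone {W : Type*} [AddCommGroup W] [Module ℝ W] (C F : Set W) : Prop :=
  ∃ f : W →ₗ[ℝ] ℝ, (∀ x ∈ C, 0 ≤ f x) ∧ F = {x | x ∈ C ∧ f x = 0}

/-- The bilinear pairing between `M_n ⊗ M_m` (Kronecker products) and `L(M_m, M_n)`. Writing
`A = ∑ A_{ij} ⊗ e_{ij}` with `A_{ij} ∈ M_n`, it is `⟨A, φ⟩ = ∑ Tr (φ (e_{ij}) A_{ij}ᵀ)`. -/
def dualPairing {m n : ℕ} (A : Matrix (Fin n × Fin m) (Fin n × Fin m) ℂ) (φ : MatrixMap m n) :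
    ℂ :=
  ∑ i : Fin m, ∑ j : Fin m,
    (φ (Matrix.single i j 1) * (Matrix.of fun k l => A (k, i) (l, j)).transpose).trace

/-- The pairing is determined by `⟨y ⊗ x, φ⟩ = Tr (φ(x) yᵀ)`. -/
theorem dualPairing_kronecker {m n : ℕ} (y : Matrix (Fin n) (Fin n) ℂ)
    (x : Matrix (Fin m) (Fin m) ℂ) (φ : MatrixMap m n) :
    dualPairing (y ⊗ₖ x) φ = (φ x * y.transpose).trace := by
  have hx : φ x = ∑ i, ∑ j, x i j • φ (Matrix.single i j 1) := by
    conv_lhs => rw [Matrix.matrix_eq_sum_single x]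
    simp only [map_sum]
    refine Finset.sum_congr rfl fun i _ => Finset.sum_congr rfl fun j _ => ?_
    rw [← map_smul, Matrix.smul_single, smul_eq_mul, mul_one]
  rw [hx]
  simp only [dualPairing, Matrix.sum_mul, Matrix.trace_sum]
  refine Finset.sum_congr rfl fun i _ => Finset.sum_congr rfl fun j _ => ?_
  have hy : (Matrix.of fun k l => (y ⊗ₖ x) (k, i) (l, j)) = x i j • y := by
    ext k l
    simp [mul_comm]
  rw [hy, Matrix.transpose_smul, Matrix.mul_smul, Matrix.smul_mul]

/-- The cone `M_n⁺ ⊗ M_m⁺` generated by the separable states: finite sums of `y ⊗ x` with `y`, `x`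
positive semidefinite. -/
def separableCone (m n : ℕ) : Set (Matrix (Fin n × Fin m) (Fin n × Fin m) ℂ) :=
  {A | ∃ (r : ℕ) (y : Fin r → Matrix (Fin n) (Fin n) ℂ) (x : Fin r → Matrix (Fin m) (Fin m) ℂ),
    (∀ s, (y s).PosSemidef) ∧ (∀ s, (x s).PosSemidef) ∧ A = ∑ s, y s ⊗ₖ x s}

/-- `F` is exposed by separable states: `F = {φ ∈ 𝔻 : ⟨A, φ⟩ = 0}` for some
`A ∈ M_n⁺ ⊗ M_m⁺`. -/
def IsExposedBySeparableStates {m n : ℕ} (F : Set (MatrixMap m n)) : Prop :=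
  ∃ A ∈ separableCone m n, F = {φ | φ ∈ decomposableCone m n ∧ dualPairing A φ = 0}

/-!
A separable functional is nonnegative on decomposable maps, so only one implication has content.
Let `f` be nonnegative on the cone and vanish exactly on `Φ_D` there. It gives two nonnegative
quadratic forms `f (φ_V)` and `f (φ^W)`, where `φ^W X = W* Xᵀ W`, with null spaces `D` and `E`. If
`W ∈ E`, then `φ^W ∈ Φ_D` is completely positive, and this forces `W` to have rank at most one
(`minor_eq_of_elementaryCopositiveMap_mem_cpFace`). Hence either `E = ℂ² ⊗ η` or `E = ξ̄ ⊗ Y`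
(`HasRankAtMostOne.classification`); put `Y = ℂη` in the first case. As `φ_V = φ^W` for
`V = x ⊗ y`, `W = x̄ ⊗ y`, the rank one matrices in `D` are the partial conjugates of those in `E`.

The key point is that `D` contains no matrix of rank one modulo the row space `Y`
(`exists_row_space`). If `E = ℂ² ⊗ η` this holds because `D` contains `ℂ² ⊗ η`, which in turn
contains every rank one matrix of `D`. If `E = ξ̄ ⊗ Y`, a
matrix `ξ ⊗ ζ + ξ' ⊗ (tζ + η)` in `D` with `η ∈ Y` would produce, by the polarization identity
`two_smul_elementaryCopositiveMap_eq`, a matrix in `E` whose `ξ̄'` component is a unit multiple of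
`tζ + η`, and so `tζ + η = 0`.

Therefore the row maps `L₀`, `L₁` of `D` modulo `Y` form a pencil that is injective at every point
of the projective line. By Liouville's theorem, if `p + αq` lies in the image of `L₀ + αL₁` for all
`α`, then `(p, q)` comes from a single element of `D`
(`IsNondegeneratePencil.exists_eq`), and if `p + ᾱq` does, then `p = q = 0`
(`IsNondegeneratePencil.eq_zero_of_conj`). In terms of product vectors: those orthogonal to `D`
detect membership in `D`, and their partial conjugates detect membership in `E`
(`HaveProductPart.mem_left`, `HaveProductPart.mem_right`). By finite dimension finitely many of them
suffice, and the sum of the corresponding product states is the exposing separable state: by Choi's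
theorem a decomposable map on which it vanishes is a sum of maps `φ_V` with `V ∈ D` and `φ^W` with
`W ∈ E`.
-/

/-! ### Pencils of linear maps over the projective line -/

section Pencil
variable {K F : Type*} [NormedAddCommGroup K] [NormedSpace ℂ K] [FiniteDimensional ℂ K]
  [NormedAddCommGroup F] [NormedSpace ℂ F]

/-- The pencil `a L₀ + b L₁` is nondegenerate: it is injective at every point `(a : b)` of the
projective line. -/
def IsNondegeneratePencil (L₀ L₁ : K →L[ℂ] F) : Prop :=
  ∀ a b : ℂ, (a ≠ 0 ∨ b ≠ 0) → ∀ d : K, a • L₀ d + b • L₁ d = 0 → d = 0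

/-- Compactness of the product of the unit spheres makes injectivity uniform. -/
theorem IsNondegeneratePencil.exists_lower_bound {L₀ L₁ : K →L[ℂ] F}
    (h : IsNondegeneratePencil L₀ L₁) :
    ∃ c : ℝ, 0 < c ∧ ∀ (a b : ℂ) (d : K), c * (max ‖a‖ ‖b‖ * ‖d‖) ≤ ‖a • L₀ d + b • L₁ d‖ := by
  have : ProperSpace K := FiniteDimensional.proper ℂ K
  let S : Set ((ℂ × ℂ) × K) := Metric.sphere 0 1 ×ˢ Metric.sphere 0 1
  have hS : IsCompact S := (isCompact_sphere _ _).prod (isCompact_sphere _ _)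
  have hcont : Continuous fun z : (ℂ × ℂ) × K => ‖z.1.1 • L₀ z.2 + z.1.2 • L₁ z.2‖ := by fun_prop
  have hunit : ∃ c : ℝ, 0 < c ∧ ∀ z ∈ S, c ≤ ‖z.1.1 • L₀ z.2 + z.1.2 • L₁ z.2‖ := by
    rcases S.eq_empty_or_nonempty with hE | hne
    · exact ⟨1, one_pos, by simp [hE]⟩
    · obtain ⟨z, hz, hmin⟩ := hS.exists_isMinOn hne hcont.continuousOn
      refine ⟨_, norm_pos_iff.2 fun h0 => ?_, fun w hw => hmin hw⟩
      have hz1 : z.1 ≠ 0 := by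
        intro h1; have := hz.1; simp [h1] at this
      have hz2 : z.2 ≠ 0 := by
        intro h1; have := hz.2; simp [h1] at this
      refine hz2 (h _ _ ?_ _ h0)
      by_contra! hcon
      exact hz1 (Prod.ext hcon.1 hcon.2)
  obtain ⟨c, hc, hle⟩ := hunit
  refine ⟨c, hc, fun a b d => ?_⟩
  by_cases hm : max ‖a‖ ‖b‖ = 0
  · simp [hm]
  by_cases hd : ‖d‖ = 0
  · simp [hd]
  have hm0 : 0 < max ‖a‖ ‖b‖ := lt_of_le_of_ne (le_max_of_le_left (norm_nonneg _)) (Ne.symm hm)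
  have hd0 : 0 < ‖d‖ := lt_of_le_of_ne (norm_nonneg _) (Ne.symm hd)
  set r : ℂ := ((max ‖a‖ ‖b‖ : ℝ) : ℂ)⁻¹ with hr
  set s : ℂ := ((‖d‖ : ℝ) : ℂ)⁻¹ with hs
  have hrn : ‖r‖ = (max ‖a‖ ‖b‖)⁻¹ := by
    rw [hr, norm_inv, Complex.norm_real, Real.norm_of_nonneg hm0.le]
  have hsn : ‖s‖ = ‖d‖⁻¹ := by rw [hs, norm_inv, Complex.norm_real, Real.norm_of_nonneg hd0.le]
  have hmem : (((r * a, r * b), s • d) : (ℂ × ℂ) × K) ∈ S := by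
    refine ⟨?_, ?_⟩
    · rw [mem_sphere_zero_iff_norm, Prod.norm_def]
      simp only [norm_mul, hrn]
      rw [← mul_max_of_nonneg _ _ (inv_nonneg.2 hm0.le), inv_mul_cancel₀ hm]
    · rw [mem_sphere_zero_iff_norm, norm_smul, hsn, inv_mul_cancel₀ hd]
  have key := hle _ hmem
  have hfac : (r * a) • L₀ (s • d) + (r * b) • L₁ (s • d) = (r * s) • (a • L₀ d + b • L₁ d) := by
    simp only [map_smul, smul_add, smul_smul]
    congr 2 <;> ring
  simp only [hfac, norm_smul, norm_mul, hrn, hsn] at key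
  calc c * (max ‖a‖ ‖b‖ * ‖d‖)
      ≤ (max ‖a‖ ‖b‖)⁻¹ * ‖d‖⁻¹ * ‖a • L₀ d + b • L₁ d‖ * (max ‖a‖ ‖b‖ * ‖d‖) := by gcongr
    _ = _ := by field_simp

/-- Solutions of the pencil equation with right-hand side `p + g(α) q`, `|g(α)| ≤ |α|`, are bounded
uniformly in `α`, and they vary continuously when `g` is `1`-Lipschitz. -/
theorem IsNondegeneratePencil.bounded_and_continuous {L₀ L₁ : K →L[ℂ] F}
    (h : IsNondegeneratePencil L₀ L₁) {p q : F} {g : ℂ → ℂ} (hg : ∀ α, ‖g α‖ ≤ ‖α‖)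
    (hg' : ∀ α β, ‖g α - g β‖ ≤ ‖α - β‖) {u : ℂ → K}
    (hu : ∀ α, L₀ (u α) + α • L₁ (u α) = p + g α • q) :
    (∃ C, ∀ α, ‖u α‖ ≤ C) ∧ Continuous u := by
  obtain ⟨c, hc, hle⟩ := h.exists_lower_bound
  have hb : ∀ α, ‖u α‖ ≤ (‖p‖ + ‖q‖) / c := by
    intro α
    have h1 := hle 1 α (u α)
    rw [one_smul, hu, norm_one] at h1
    have h2 : ‖p + g α • q‖ ≤ max 1 ‖α‖ * (‖p‖ + ‖q‖) := by
      calc ‖p + g α • q‖ ≤ ‖p‖ + ‖g α‖ * ‖q‖ := (norm_add_le _ _).trans (by rw [norm_smul])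
        _ ≤ max 1 ‖α‖ * ‖p‖ + max 1 ‖α‖ * ‖q‖ := by
          gcongr
          · exact le_mul_of_one_le_left (norm_nonneg _) (le_max_left _ _)
          · exact (hg α).trans (le_max_right _ _)
        _ = _ := by ring
    have h3 : (0 : ℝ) < max 1 ‖α‖ := lt_of_lt_of_le one_pos (le_max_left _ _)
    rw [le_div_iff₀ hc]
    refine le_of_mul_le_mul_left ?_ h3
    calc max 1 ‖α‖ * (‖u α‖ * c) = c * (max 1 ‖α‖ * ‖u α‖) := by ring
      _ ≤ _ := h1.trans h2
  refine ⟨⟨_, hb⟩, ?_⟩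
  set C := (‖p‖ + ‖q‖) / c
  have hlip : ∀ α β, ‖u α - u β‖ ≤ (‖q‖ + ‖L₁‖ * C) / c * ‖α - β‖ := by
    intro α β
    have h1 := hle 1 β (u α - u β)
    have h2 : (1 : ℂ) • L₀ (u α - u β) + β • L₁ (u α - u β)
        = (g α - g β) • q - (α - β) • L₁ (u α) := by
      have e : (1 : ℂ) • L₀ (u α - u β) + β • L₁ (u α - u β)
          = (L₀ (u α) + α • L₁ (u α)) - (L₀ (u β) + β • L₁ (u β)) - (α - β) • L₁ (u α) := by
        simp only [map_sub]; module
      rw [e, hu, hu]; module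
    rw [h2, norm_one] at h1
    have h3 : ‖(g α - g β) • q - (α - β) • L₁ (u α)‖ ≤ (‖q‖ + ‖L₁‖ * C) * ‖α - β‖ := by
      calc _ ≤ ‖g α - g β‖ * ‖q‖ + ‖α - β‖ * ‖L₁ (u α)‖ := by
            refine (norm_sub_le _ _).trans ?_; rw [norm_smul, norm_smul]
        _ ≤ ‖α - β‖ * ‖q‖ + ‖α - β‖ * (‖L₁‖ * C) := by
            gcongr
            · exact hg' α β
            · exact (L₁.le_opNorm _).trans (by gcongr; exact hb α)
        _ = _ := by ring
    have h4 : c * ‖u α - u β‖ ≤ c * (max 1 ‖β‖ * ‖u α - u β‖) := by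
      gcongr; exact le_mul_of_one_le_left (norm_nonneg _) (le_max_left _ _)
    have h5 := h4.trans (h1.trans h3)
    rw [div_mul_eq_mul_div, le_div_iff₀ hc]
    linarith
  have hL : LipschitzWith (Real.toNNReal ((‖q‖ + ‖L₁‖ * C) / c)) u :=
    LipschitzWith.of_dist_le_mul fun α β => by
      rw [dist_eq_norm, dist_eq_norm]
      exact (hlip α β).trans (by gcongr; exact Real.le_coe_toNNReal _)
  exact hL.continuous

/-- A global section of the image of a nondegenerate pencil, affine in the parameter, is the image
of a constant: the preimage is a bounded entire function of the parameter. -/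
theorem IsNondegeneratePencil.exists_eq {L₀ L₁ : K →L[ℂ] F} (h : IsNondegeneratePencil L₀ L₁)
    {p q : F} (hpq : ∀ α : ℂ, ∃ d, L₀ d + α • L₁ d = p + α • q) :
    ∃ d, L₀ d = p ∧ L₁ d = q := by
  choose u hu using hpq
  obtain ⟨⟨C, hC⟩, hcont⟩ := h.bounded_and_continuous (g := id) (fun _ => le_rfl)
    (fun _ _ => le_rfl) hu
  have hdiff : Differentiable ℂ u := by
    intro β
    have hinj : LinearMap.ker ((L₀ + β • L₁ : K →L[ℂ] F) : K →ₗ[ℂ] F) = ⊥ := by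
      rw [LinearMap.ker_eq_bot']
      intro d hd
      exact h 1 β (Or.inl one_ne_zero) d (by simpa using hd)
    obtain ⟨M, hM⟩ := LinearMap.exists_leftInverse_of_injective _ hinj
    have hM' : ∀ d, M (L₀ d + β • L₁ d) = d := fun d => by
      simpa using LinearMap.congr_fun hM d
    have hslope : ∀ α, u α - u β = (α - β) • (M q - M (L₁ (u α))) := by
      intro α
      have e : L₀ (u α - u β) + β • L₁ (u α - u β)
          = (L₀ (u α) + α • L₁ (u α)) - (L₀ (u β) + β • L₁ (u β)) - (α - β) • L₁ (u α) := by
        simp only [map_sub]; module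
      have e' : L₀ (u α - u β) + β • L₁ (u α - u β) = (α - β) • (q - L₁ (u α)) := by
        rw [e, hu, hu]; module
      rw [← map_sub, ← map_smul, ← e', hM']
    have hML : Continuous fun k : K => M (L₁ k) :=
      LinearMap.continuous_of_finiteDimensional (M ∘ₗ (L₁ : K →ₗ[ℂ] F))
    have hder : HasDerivAt u (M q - M (L₁ (u β))) β := by
      rw [hasDerivAt_iff_tendsto_slope]
      have ht : Filter.Tendsto (fun α => M q - M (L₁ (u α))) (nhdsWithin β {β}ᶜ)
          (nhds (M q - M (L₁ (u β)))) :=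
        ((continuous_const.sub (hML.comp hcont)).tendsto β).mono_left nhdsWithin_le_nhds
      refine ht.congr' ?_
      filter_upwards [self_mem_nhdsWithin] with α hα
      rw [slope_def_module, hslope, smul_smul, inv_mul_cancel₀ (sub_ne_zero.2 hα), one_smul]
    exact hder.differentiableAt
  have hconst : ∀ α, u α = u 0 := fun α =>
    hdiff.apply_eq_apply_of_bounded
      (isBounded_iff_forall_norm_le.2 ⟨C, by rintro _ ⟨α, rfl⟩; exact hC α⟩) α 0
  have h0 : L₀ (u 0) = p := by simpa using hu 0
  refine ⟨u 0, h0, ?_⟩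
  have h1 := hu 1
  rw [hconst 1, h0] at h1
  simpa using h1

/-- The conjugate counterpart of `IsNondegeneratePencil.exists_eq`: only zero is conjugate-affine.
The Cauchy–Riemann combination of the difference quotients along the real and imaginary axes
shows that `q` itself lies in every image of the pencil. -/
theorem IsNondegeneratePencil.eq_zero_of_conj {L₀ L₁ : K →L[ℂ] F}
    (h : IsNondegeneratePencil L₀ L₁) {p q : F}
    (hpq : ∀ α : ℂ, ∃ d, L₀ d + α • L₁ d = p + (starRingEnd ℂ α) • q) :
    p = 0 ∧ q = 0 := by
  choose u hu using hpq
  obtain ⟨-, hcont⟩ := h.bounded_and_continuous (g := starRingEnd ℂ)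
    (fun α => by rw [RCLike.norm_conj]) (fun α β => by rw [← map_sub, RCLike.norm_conj]) hu
  have hzero : ∀ r : F, (∀ β : ℂ, ∃ d, L₀ d + β • L₁ d = r) → r = 0 := by
    intro r hr
    obtain ⟨d, hd0, hd1⟩ := h.exists_eq (p := r) (q := 0) (by simpa using hr)
    have : d = 0 := h 0 1 (Or.inr one_ne_zero) d (by simp [hd1])
    rw [← hd0, this, map_zero]
  have hq : ∀ β : ℂ, ∃ d, L₀ d + β • L₁ d = q := by
    intro β
    let R : Submodule ℂ F := LinearMap.range ((L₀ + β • L₁ : K →L[ℂ] F) : K →ₗ[ℂ] F)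
    have hRmem : ∀ d, L₀ d + β • L₁ d ∈ R := fun d => ⟨d, by simp⟩
    have hRclosed : IsClosed (R : Set F) := R.closed_of_finiteDimensional
    have hdiff : ∀ α, (starRingEnd ℂ α - starRingEnd ℂ β) • q - (α - β) • L₁ (u α) ∈ R := by
      intro α
      have e : L₀ (u α - u β) + β • L₁ (u α - u β)
          = (L₀ (u α) + α • L₁ (u α)) - (L₀ (u β) + β • L₁ (u β)) - (α - β) • L₁ (u α) := by
        simp only [map_sub]; module
      have := hRmem (u α - u β)
      rw [e, hu, hu] at this
      convert this using 1
      module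
    have hsum : ∀ t : ℝ, t ≠ 0 →
        (2 : ℂ) • q - L₁ (u (β + t)) + L₁ (u (β + t * Complex.I)) ∈ R := by
      intro t ht
      have ht' : (t : ℂ) ≠ 0 := by exact_mod_cast ht
      have m1 := R.smul_mem ((t : ℂ)⁻¹) (hdiff (β + t))
      have m2 := R.smul_mem ((t : ℂ)⁻¹ * Complex.I) (hdiff (β + t * Complex.I))
      have m := R.add_mem m1 m2
      convert m using 1
      simp only [map_add, map_mul, Complex.conj_ofReal, Complex.conj_I, add_sub_cancel_left,
        smul_sub, smul_smul]
      have e1 : (t : ℂ)⁻¹ * t = 1 := inv_mul_cancel₀ ht'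
      have e2 : (t : ℂ)⁻¹ * Complex.I * (t * -Complex.I) = 1 := by
        linear_combination (-Complex.I * Complex.I) * e1 - Complex.I_mul_I
      have e3 : (t : ℂ)⁻¹ * Complex.I * (t * Complex.I) = -1 := by
        linear_combination (Complex.I * Complex.I) * e1 + Complex.I_mul_I
      rw [e1, e2, e3]
      module
    have hlim : (2 : ℂ) • q ∈ R := by
      have hc : Continuous fun t : ℝ =>
          (2 : ℂ) • q - L₁ (u (β + t)) + L₁ (u (β + t * Complex.I)) := by fun_prop
      have ht := (hc.tendsto 0).mono_left (nhdsWithin_le_nhds (s := {0}ᶜ))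
      have := hRclosed.mem_of_tendsto ht (by
        filter_upwards [self_mem_nhdsWithin] with t ht using hsum t ht)
      simpa using this
    have := R.smul_mem (2⁻¹ : ℂ) hlim
    rw [smul_smul, inv_mul_cancel₀ two_ne_zero, one_smul] at this
    obtain ⟨d, hd⟩ := this
    exact ⟨d, by simpa using hd⟩
  have hp : ∀ β : ℂ, ∃ d, L₀ d + β • L₁ d = p := by
    intro β
    obtain ⟨d, hd⟩ := hq β
    refine ⟨u β - (starRingEnd ℂ β) • d, ?_⟩
    have e : L₀ (u β - (starRingEnd ℂ β) • d) + β • L₁ (u β - (starRingEnd ℂ β) • d)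
        = (L₀ (u β) + β • L₁ (u β)) - (starRingEnd ℂ β) • (L₀ d + β • L₁ d) := by
      simp only [map_sub, map_smul]; module
    rw [e, hu, hd]; module
  exact ⟨hzero p hp, hzero q hq⟩

end Pencil

/-! ### Elementary maps and polarization -/

section Maps
variable {m n : ℕ}

/-- The elementary completely copositive map `φ^V : X ↦ V* Xᵀ V`. -/
def elementaryCopositiveMap (V : Matrix (Fin m) (Fin n) ℂ) : MatrixMap m n :=
  elementaryMap V ∘ₗ transposition m

/-- Precomposition with the transposition, as a real linear map. -/
def transposeDomain (m n : ℕ) : MatrixMap m n →ₗ[ℝ] MatrixMap m n where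
  toFun φ := φ ∘ₗ transposition m
  map_add' _ _ := rfl
  map_smul' _ _ := rfl

/-- The polarization `X ↦ V* X U + U* X V` of the quadratic map `V ↦ φ_V`. -/
def polarizedMap (V U : Matrix (Fin m) (Fin n) ℂ) : MatrixMap m n where
  toFun X := V.conjTranspose * X * U + U.conjTranspose * X * V
  map_add' X Y := by simp only [Matrix.mul_add, Matrix.add_mul]; abel
  map_smul' c X := by
    simp only [Matrix.mul_smul, Matrix.smul_mul, RingHom.id_apply, smul_add]

theorem transposition_apply (X : Matrix (Fin m) (Fin m) ℂ) : transposition m X = X.transpose := rfl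

theorem elementaryMap_apply_apply (V : Matrix (Fin m) (Fin n) ℂ) (X : Matrix (Fin m) (Fin m) ℂ)
    (k l : Fin n) :
    elementaryMap V X k l = ∑ j, (∑ i, star (V i k) * X i j) * V j l := by
  simp [elementaryMap, Matrix.mul_apply]

theorem polarizedMap_apply_apply (V U : Matrix (Fin m) (Fin n) ℂ) (X : Matrix (Fin m) (Fin m) ℂ)
    (k l : Fin n) :
    polarizedMap V U X k l = ∑ j, (∑ i, star (V i k) * X i j) * U j l
      + ∑ j, (∑ i, star (U i k) * X i j) * V j l := by
  simp [polarizedMap, Matrix.mul_apply]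

theorem elementaryMap_single_apply (V : Matrix (Fin m) (Fin n) ℂ) (i j : Fin m) (k l : Fin n) :
    elementaryMap V (Matrix.single i j 1) k l = star (V i k) * V j l := by
  rw [elementaryMap_apply_apply]
  simp only [Matrix.single_apply]
  rw [Finset.sum_eq_single j]
  · rw [Finset.sum_eq_single i] <;> simp +contextual [eq_comm]
  · intro b _ hb
    rw [Finset.sum_eq_zero, zero_mul]
    intro a _
    simp [hb.symm]
  · simp

theorem elementaryMap_add (V U : Matrix (Fin m) (Fin n) ℂ) :
    elementaryMap (V + U) = elementaryMap V + elementaryMap U + polarizedMap V U := by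
  refine LinearMap.ext fun X => ?_
  simp only [elementaryMap, polarizedMap, LinearMap.coe_mk, AddHom.coe_mk, LinearMap.add_apply,
    Matrix.conjTranspose_add, Matrix.add_mul, Matrix.mul_add]
  abel

theorem elementaryMap_smul (c : ℂ) (V : Matrix (Fin m) (Fin n) ℂ) :
    elementaryMap (c • V) = (‖c‖ ^ 2 : ℝ) • elementaryMap V := by
  refine LinearMap.ext fun X => ?_
  simp only [elementaryMap, LinearMap.coe_mk, AddHom.coe_mk, LinearMap.smul_apply,
    Matrix.conjTranspose_smul, Matrix.smul_mul, Matrix.mul_smul, smul_smul]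
  rw [← Complex.coe_smul, RCLike.star_def, Complex.mul_conj']
  push_cast
  rfl

theorem polarizedMap_real_smul (s : ℝ) (V U : Matrix (Fin m) (Fin n) ℂ) :
    polarizedMap V ((s : ℂ) • U) = s • polarizedMap V U := by
  refine LinearMap.ext fun X => ?_
  simp only [polarizedMap, LinearMap.coe_mk, AddHom.coe_mk, LinearMap.smul_apply,
    Matrix.conjTranspose_smul, Matrix.smul_mul, Matrix.mul_smul, smul_add]
  rw [RCLike.star_def, Complex.conj_ofReal, Complex.coe_smul, Complex.coe_smul]

/-- A nonnegative quadratic form that vanishes at `V` has `V` in its radical. -/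
theorem apply_polarizedMap_eq_zero {f : MatrixMap m n →ₗ[ℝ] ℝ}
    (hf : ∀ V, 0 ≤ f (elementaryMap V)) {V : Matrix (Fin m) (Fin n) ℂ}
    (hV : f (elementaryMap V) = 0) (U : Matrix (Fin m) (Fin n) ℂ) :
    f (polarizedMap V U) = 0 := by
  have key : ∀ s : ℝ, 0 ≤ f (elementaryMap U) * (s * s) + f (polarizedMap V U) * s + 0 := by
    intro s
    have := hf (V + (s : ℂ) • U)
    rw [elementaryMap_add, elementaryMap_smul, polarizedMap_real_smul, map_add, map_add, hV,
      map_smul, map_smul, Complex.norm_real, Real.norm_eq_abs, sq_abs, smul_eq_mul,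
      smul_eq_mul] at this
    linarith [this]
  have hd := discrim_le_zero key
  rw [discrim] at hd
  nlinarith [sq_nonneg (f (polarizedMap V U))]

theorem apply_elementaryMap_add_eq_zero {f : MatrixMap m n →ₗ[ℝ] ℝ}
    (hf : ∀ V, 0 ≤ f (elementaryMap V)) {V U : Matrix (Fin m) (Fin n) ℂ}
    (hV : f (elementaryMap V) = 0) (hU : f (elementaryMap U) = 0) :
    f (elementaryMap (V + U)) = 0 := by
  rw [elementaryMap_add, map_add, map_add, hV, hU, apply_polarizedMap_eq_zero hf hV]
  simp

/-- The zero set of the nonnegative quadratic form `V ↦ f (φ_V)`. -/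
def nullSpace (f : MatrixMap m n →ₗ[ℝ] ℝ) (hf : ∀ V, 0 ≤ f (elementaryMap V)) :
    Submodule ℂ (Matrix (Fin m) (Fin n) ℂ) where
  carrier := {V | f (elementaryMap V) = 0}
  add_mem' := apply_elementaryMap_add_eq_zero hf
  zero_mem' := by
    have : elementaryMap (0 : Matrix (Fin m) (Fin n) ℂ) = 0 := by
      refine LinearMap.ext fun X => ?_
      simp [elementaryMap]
    simp [this]
  smul_mem' c V hV := by
    simp only [Set.mem_ofPred_eq] at hV ⊢
    rw [elementaryMap_smul, map_smul, hV, smul_zero]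

/-- On rank one matrices the two elementary maps agree up to conjugating the left factor. -/
theorem elementaryCopositiveMap_vecMulVec_star (x : Fin m → ℂ) (y : Fin n → ℂ) :
    elementaryCopositiveMap (Matrix.vecMulVec (star x) y)
      = elementaryMap (Matrix.vecMulVec x y) := by
  refine LinearMap.ext fun X => Matrix.ext fun k l => ?_
  simp only [elementaryCopositiveMap, LinearMap.comp_apply, elementaryMap_apply_apply,
    transposition_apply, Matrix.transpose_apply, Matrix.vecMulVec_apply, Finset.sum_mul]
  rw [Finset.sum_comm]
  refine Finset.sum_congr rfl fun i _ => Finset.sum_congr rfl fun j _ => ?_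
  simp only [star_mul', Pi.star_apply, star_star]
  ring

/-! ### Kraus decompositions of decomposable maps -/

theorem isCompletelyPositive_elementaryMap (V : Matrix (Fin m) (Fin n) ℂ) :
    IsCompletelyPositive (elementaryMap V) := by
  intro k X hX
  have h : blockwiseMap k (elementaryMap V) X
      = ((1 : Matrix (Fin k) (Fin k) ℂ) ⊗ₖ V).conjTranspose * X
        * ((1 : Matrix (Fin k) (Fin k) ℂ) ⊗ₖ V) := by
    ext ⟨a, i⟩ ⟨b, j⟩
    simp only [blockwiseMap, Matrix.of_apply, elementaryMap_apply_apply, Matrix.mul_apply,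
      Fintype.sum_prod_type, Matrix.conjTranspose_apply, Matrix.kroneckerMap_apply, star_mul',
      Matrix.one_apply, apply_ite star, star_one, star_zero]
    rw [Finset.sum_eq_single b]
    · refine Finset.sum_congr rfl fun q _ => ?_
      rw [Finset.sum_eq_single a]
      · simp
      · intro c _ hc; simp [hc]
      · simp
    · intro c _ hc; simp [hc]
    · simp
  rw [h]
  exact hX.conjTranspose_mul_mul_same _

theorem transposition_comp_self (m : ℕ) : transposition m ∘ₗ transposition m = LinearMap.id := by
  refine LinearMap.ext fun X => ?_
  simp [transposition_apply]

theorem isCompletelyCopositive_elementaryCopositiveMap (V : Matrix (Fin m) (Fin n) ℂ) :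
    IsCompletelyCopositive (elementaryCopositiveMap V) := by
  rw [IsCompletelyCopositive, elementaryCopositiveMap, LinearMap.comp_assoc,
    transposition_comp_self, LinearMap.comp_id]
  exact isCompletelyPositive_elementaryMap V

theorem isCompletelyPositive_zero : IsCompletelyPositive (0 : MatrixMap m n) := by
  intro k X _
  have : blockwiseMap k (0 : MatrixMap m n) X = 0 := by ext; simp [blockwiseMap]
  rw [this]
  exact Matrix.PosSemidef.zero

theorem elementaryMap_mem_decomposableCone (V : Matrix (Fin m) (Fin n) ℂ) :
    elementaryMap V ∈ decomposableCone m n :=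
  ⟨_, 0, isCompletelyPositive_elementaryMap V, by
    rw [IsCompletelyCopositive, LinearMap.zero_comp]; exact isCompletelyPositive_zero,
    (add_zero _).symm⟩

theorem elementaryCopositiveMap_mem_decomposableCone (V : Matrix (Fin m) (Fin n) ℂ) :
    elementaryCopositiveMap V ∈ decomposableCone m n :=
  ⟨0, _, isCompletelyPositive_zero, isCompletelyCopositive_elementaryCopositiveMap V,
    (zero_add _).symm⟩

theorem matrixMap_ext_single {φ ψ : MatrixMap m n}
    (h : ∀ i j k l, φ (Matrix.single i j 1) k l = ψ (Matrix.single i j 1) k l) : φ = ψ := by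
  refine LinearMap.ext fun X => ?_
  have hx : ∀ χ : MatrixMap m n, χ X = ∑ i, ∑ j, X i j • χ (Matrix.single i j 1) := by
    intro χ
    conv_lhs => rw [Matrix.matrix_eq_sum_single X]
    simp only [map_sum]
    refine Finset.sum_congr rfl fun i _ => Finset.sum_congr rfl fun j _ => ?_
    rw [← map_smul, Matrix.smul_single, smul_eq_mul, mul_one]
  rw [hx, hx]
  refine Finset.sum_congr rfl fun i _ => Finset.sum_congr rfl fun j _ => ?_
  congr 1
  ext k l
  exact h i j k l

open scoped MatrixOrder in
/-- Choi's theorem: a completely positive map has a Kraus decomposition, read off from a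
factorization `B* B` of its positive semidefinite Choi matrix. -/
theorem IsCompletelyPositive.exists_eq_sum {φ : MatrixMap m n} (hφ : IsCompletelyPositive φ) :
    ∃ V : Fin m × Fin n → Matrix (Fin m) (Fin n) ℂ, φ = ∑ r, elementaryMap (V r) := by
  let ω : Fin m × Fin m → ℂ := fun p => if p.1 = p.2 then 1 else 0
  have hΩ := hφ m (Matrix.vecMulVec ω (star ω)) (Matrix.posSemidef_vecMulVec_self_star ω)
  have hblock : ∀ i j : Fin m,
      (Matrix.of fun a b => Matrix.vecMulVec ω (star ω) (i, a) (j, b)) = Matrix.single i j 1 := by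
    intro i j
    ext a b
    simp only [Matrix.of_apply, Matrix.vecMulVec_apply, Matrix.single_apply, ω, Pi.star_apply]
    by_cases h1 : i = a <;> by_cases h2 : j = b <;> simp [h1, h2]
  obtain ⟨B, hB⟩ := CStarAlgebra.nonneg_iff_eq_star_mul_self.mp hΩ.nonneg
  refine ⟨fun r => Matrix.of fun i k => B r (i, k), matrixMap_ext_single fun i j k l => ?_⟩
  have := congrFun (congrFun hB (i, k)) (j, l)
  simp only [blockwiseMap, Matrix.of_apply, hblock] at this
  rw [this, LinearMap.sum_apply, Matrix.sum_apply]
  simp [elementaryMap_single_apply, Matrix.mul_apply, Matrix.star_apply]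

/-- A decomposable map is a sum of elementary maps of the two kinds. -/
theorem exists_eq_sum_of_mem_decomposableCone {φ : MatrixMap m n}
    (hφ : φ ∈ decomposableCone m n) :
    ∃ V W : Fin m × Fin n → Matrix (Fin m) (Fin n) ℂ,
      φ = ∑ r, elementaryMap (V r) + ∑ r, elementaryCopositiveMap (W r) := by
  obtain ⟨ψ, χ, hψ, hχ, rfl⟩ := hφ
  obtain ⟨V, rfl⟩ := hψ.exists_eq_sum
  obtain ⟨W, hW⟩ := IsCompletelyPositive.exists_eq_sum hχ
  refine ⟨V, W, ?_⟩
  congr 1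
  calc χ = (χ ∘ₗ transposition m) ∘ₗ transposition m := by
        rw [LinearMap.comp_assoc, transposition_comp_self, LinearMap.comp_id]
    _ = _ := by
        rw [hW]
        refine LinearMap.ext fun X => ?_
        simp [LinearMap.sum_apply, elementaryCopositiveMap]

end Maps

/-! ### The set `cpFace D` and the Choi form -/

section Face
variable {m n : ℕ} {D : Submodule ℂ (Matrix (Fin m) (Fin n) ℂ)}

theorem elementaryMap_mem_cpFace {V : Matrix (Fin m) (Fin n) ℂ} (hV : V ∈ D) :
    elementaryMap V ∈ cpFace D :=
  ⟨{V}, by simpa using hV, by simp⟩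

theorem smul_mem_cpFace {φ : MatrixMap m n} (hφ : φ ∈ cpFace D) {r : ℝ} (hr : 0 < r) :
    r • φ ∈ cpFace D := by
  obtain ⟨S, hS, rfl⟩ := hφ
  have hc : ((√r : ℝ) : ℂ) ≠ 0 := by exact_mod_cast (Real.sqrt_pos.2 hr).ne'
  refine ⟨S.map ⟨fun V => ((√r : ℝ) : ℂ) • V, smul_right_injective _ hc⟩, ?_, ?_⟩
  · intro V hV
    obtain ⟨U, hU, rfl⟩ := Finset.mem_map.1 (Finset.mem_coe.1 hV)
    exact D.smul_mem _ (hS hU)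
  · simp only [Finset.sum_map, Function.Embedding.coeFn_mk, elementaryMap_smul, Finset.smul_sum]
    refine Finset.sum_congr rfl fun V _ => ?_
    rw [Complex.norm_real, Real.norm_eq_abs, sq_abs, Real.sq_sqrt hr.le]

/-- The summands in `cpFace D` are required to be distinct, so that closure under addition is not
immediate; it follows from convexity by scaling. -/
theorem add_mem_cpFace (hD : Convex ℝ (cpFace D)) {φ ψ : MatrixMap m n} (hφ : φ ∈ cpFace D)
    (hψ : ψ ∈ cpFace D) : φ + ψ ∈ cpFace D := by
  have h := hD (smul_mem_cpFace hφ two_pos) (smul_mem_cpFace hψ two_pos)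
    (a := 1 / 2) (b := 1 / 2) (by norm_num) (by norm_num) (by norm_num)
  simpa [smul_smul] using h

theorem sum_mem_cpFace (hD : Convex ℝ (cpFace D)) {ι : Type*} (s : Finset ι)
    {φ : ι → MatrixMap m n} (hφ : ∀ i ∈ s, φ i ∈ cpFace D) : ∑ i ∈ s, φ i ∈ cpFace D :=
  Finset.sum_induction φ (· ∈ cpFace D) (fun _ _ => add_mem_cpFace hD) ⟨∅, by simp, by simp⟩ hφ

/-- The value of the quadratic form of the Choi matrix of `φ` at the vector `c`. -/
def choiForm (c : Matrix (Fin m) (Fin n) ℂ) : MatrixMap m n →ₗ[ℂ] ℂ where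
  toFun φ := ∑ i, ∑ j, ∑ k, ∑ l, star (c i k) * c j l * φ (Matrix.single i j 1) k l
  map_add' φ ψ := by
    simp only [LinearMap.add_apply, Matrix.add_apply, mul_add, Finset.sum_add_distrib]
  map_smul' r φ := by
    simp only [LinearMap.smul_apply, Matrix.smul_apply, smul_eq_mul, Finset.mul_sum,
      RingHom.id_apply]
    refine Finset.sum_congr rfl fun _ _ => Finset.sum_congr rfl fun _ _ =>
      Finset.sum_congr rfl fun _ _ => Finset.sum_congr rfl fun _ _ => by ring

theorem choiForm_elementaryMap (c V : Matrix (Fin m) (Fin n) ℂ) :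
    choiForm c (elementaryMap V)
      = star (∑ i, ∑ k, c i k * V i k) * ∑ i, ∑ k, c i k * V i k := by
  simp only [choiForm, LinearMap.coe_mk, AddHom.coe_mk, elementaryMap_single_apply, star_sum,
    star_mul', Finset.sum_mul_sum]
  refine Finset.sum_congr rfl fun i _ => Finset.sum_congr rfl fun j _ =>
    Finset.sum_congr rfl fun k _ => Finset.sum_congr rfl fun l _ => by ring

theorem choiForm_elementaryCopositiveMap (c W : Matrix (Fin m) (Fin n) ℂ) :
    choiForm c (elementaryCopositiveMap W)
      = ∑ i, ∑ j, star (∑ k, c i k * W j k) * ∑ k, c j k * W i k := by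
  simp only [choiForm, LinearMap.coe_mk, AddHom.coe_mk, elementaryCopositiveMap,
    LinearMap.comp_apply, transposition_apply, Matrix.transpose_single,
    elementaryMap_single_apply, star_sum, star_mul', Finset.sum_mul_sum]
  refine Finset.sum_congr rfl fun i _ => Finset.sum_congr rfl fun j _ =>
    Finset.sum_congr rfl fun k _ => Finset.sum_congr rfl fun l _ => by ring

theorem choiForm_nonneg {φ : MatrixMap m n} (hφ : φ ∈ cpFace D) (c : Matrix (Fin m) (Fin n) ℂ) :
    0 ≤ choiForm c φ := by
  obtain ⟨S, -, rfl⟩ := hφ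
  rw [map_sum]
  refine Finset.sum_nonneg fun V _ => ?_
  rw [choiForm_elementaryMap]
  exact star_mul_self_nonneg _

/-- A functional `ℓ` that vanishes on `D` gives a Choi form that vanishes on `cpFace D` and equals
`|ℓ V|²` at `φ_V`. -/
theorem elementaryMap_mem_cpFace_iff {V : Matrix (Fin m) (Fin n) ℂ} :
    elementaryMap V ∈ cpFace D ↔ V ∈ D := by
  refine ⟨fun h => ?_, elementaryMap_mem_cpFace⟩
  by_contra hV
  obtain ⟨ℓ, hℓ, hℓD⟩ := D.exists_dual_map_eq_bot_of_notMem hV inferInstance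
  have hℓ0 : ∀ U ∈ D, ℓ U = 0 := fun U hU => by
    have : ℓ U ∈ D.map ℓ := ⟨U, hU, rfl⟩
    rwa [hℓD, Submodule.mem_bot] at this
  have hval : ∀ U : Matrix (Fin m) (Fin n) ℂ,
      ∑ i, ∑ k, ℓ (Matrix.single i k 1) * U i k = ℓ U := by
    intro U
    conv_rhs => rw [Matrix.matrix_eq_sum_single U]
    simp only [map_sum]
    refine Finset.sum_congr rfl fun i _ => Finset.sum_congr rfl fun k _ => ?_
    rw [mul_comm, ← smul_eq_mul, ← map_smul, Matrix.smul_single, smul_eq_mul, mul_one]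
  obtain ⟨S, hS, hsum⟩ := h
  have h2 := congrArg (choiForm (Matrix.of fun i k => ℓ (Matrix.single i k 1))) hsum
  simp only [map_sum, choiForm_elementaryMap, Matrix.of_apply, hval] at h2
  rw [Finset.sum_eq_zero fun U hU => by rw [hℓ0 U (hS hU), mul_zero]] at h2
  simp [hℓ] at h2

/-- If `X ↦ W* Xᵀ W` is a sum of elementary completely positive maps and `W` has two rows, then `W`
has rank at most one: otherwise the Choi form is negative somewhere. -/
theorem minor_eq_of_elementaryCopositiveMap_mem_cpFace
    {D : Submodule ℂ (Matrix (Fin 2) (Fin n) ℂ)} {W : Matrix (Fin 2) (Fin n) ℂ}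
    (h : elementaryCopositiveMap W ∈ cpFace D) (k l : Fin n) :
    W 0 k * W 1 l = W 0 l * W 1 k := by
  -- At this vector the Choi form of `X ↦ W* Xᵀ W` is `-2 |δ|²`, where `δ` is the minor.
  have h1 := choiForm_nonneg h
    (Matrix.of fun i => Pi.single k (W i l) - Pi.single l (W i k))
  have hs : ∀ a b : Fin 2,
      ∑ j, (Matrix.of fun i => (Pi.single k (W i l) - Pi.single l (W i k) : Fin n → ℂ)) a j * W b j
        = W a l * W b k - W a k * W b l := by
    intro a b
    simp [sub_mul, Finset.sum_sub_distrib, Pi.single_apply, ite_mul]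
  rw [choiForm_elementaryCopositiveMap] at h1
  simp only [hs, Fin.sum_univ_two] at h1
  set δ := W 0 k * W 1 l - W 0 l * W 1 k with hδ
  have e : star (W 0 l * W 0 k - W 0 k * W 0 l) * (W 0 l * W 0 k - W 0 k * W 0 l)
      + star (W 0 l * W 1 k - W 0 k * W 1 l) * (W 1 l * W 0 k - W 1 k * W 0 l)
      + (star (W 1 l * W 0 k - W 1 k * W 0 l) * (W 0 l * W 1 k - W 0 k * W 1 l)
      + star (W 1 l * W 1 k - W 1 k * W 1 l) * (W 1 l * W 1 k - W 1 k * W 1 l))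
      = -(2 * (star δ * δ)) := by
    rw [hδ]; simp only [star_sub, star_mul']; ring
  rw [e] at h1
  have h2 : (0 : ℂ) ≤ star δ * δ := star_mul_self_nonneg δ
  have h3 : star δ * δ = 0 := by
    refine le_antisymm ?_ h2
    have : (0:ℂ) ≤ 2⁻¹ * -(2 * (star δ * δ)) := mul_nonneg (by positivity) h1
    have e2 : (2:ℂ)⁻¹ * -(2 * (star δ * δ)) = - (star δ * δ) := by ring
    rw [e2] at this
    exact neg_nonneg.1 this
  have h4 : δ = 0 := by simpa using h3
  exact sub_eq_zero.1 h4

end Face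

/-! ### Spanning by product vectors -/

section Spanning
variable {n : ℕ}

theorem vecMul_fin_two (x : Fin 2 → ℂ) (V : Matrix (Fin 2) (Fin n) ℂ) :
    Matrix.vecMul x V = x 0 • V 0 + x 1 • V 1 := by
  ext k
  simp [Matrix.vecMul, dotProduct, Fin.sum_univ_two]

/-- No matrix of `D` has rank exactly one modulo the row space `Y`: if some nontrivial combination
of the two rows of `V ∈ D` lies in `Y`, then both rows do. -/
def NoRankOneModulo (D : Submodule ℂ (Matrix (Fin 2) (Fin n) ℂ))
    (Y : Submodule ℂ (Fin n → ℂ)) : Prop :=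
  ∀ V ∈ D, ∀ a b : ℂ, (a ≠ 0 ∨ b ≠ 0) → a • V 0 + b • V 1 ∈ Y → V 0 ∈ Y ∧ V 1 ∈ Y

/-- Modulo `Y`, a matrix `V` with `xᵀ V ∈ xᵀ D` for all `x` lies in `D`, and a matrix `W` with
`x* W ∈ xᵀ D` for all `x` vanishes. Indeed the two row maps on `D` modulo `Y` form a nondegenerate
pencil, and in the affine chart `x = (1, α)` the hypotheses are those of
`IsNondegeneratePencil.exists_eq` and `IsNondegeneratePencil.eq_zero_of_conj`. -/
theorem NoRankOneModulo.spanning {D : Submodule ℂ (Matrix (Fin 2) (Fin n) ℂ)}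
    {Y : Submodule ℂ (Fin n → ℂ)} (h : NoRankOneModulo D Y) :
    (∀ V : Matrix (Fin 2) (Fin n) ℂ, (∀ x, ∃ d ∈ D, Matrix.vecMul x V = Matrix.vecMul x d) →
      ∃ d ∈ D, V 0 - d 0 ∈ Y ∧ V 1 - d 1 ∈ Y) ∧
    (∀ W : Matrix (Fin 2) (Fin n) ℂ,
      (∀ x, ∃ d ∈ D, Matrix.vecMul (star x) W = Matrix.vecMul x d) → W 0 ∈ Y ∧ W 1 ∈ Y) := by
  -- The quotient by `Y` is realized as the image of an endomorphism with kernel `Y`.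
  obtain ⟨π, hπ⟩ : ∃ π : (Fin n → ℂ) →ₗ[ℂ] (Fin n → ℂ), ∀ z, π z = 0 ↔ z ∈ Y := by
    obtain ⟨s, hs⟩ := Y.mkQ.exists_rightInverse_of_surjective Y.range_mkQ
    have hs' : Function.Injective s := fun a b hab => by
      rw [← LinearMap.id_apply (R := ℂ) a, ← hs, LinearMap.comp_apply, hab,
        ← LinearMap.comp_apply, hs, LinearMap.id_apply]
    exact ⟨s ∘ₗ Y.mkQ, fun z => by
      rw [LinearMap.comp_apply, map_eq_zero_iff s hs', Submodule.mkQ_apply,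
        Submodule.Quotient.mk_eq_zero]⟩
  let F := Fin n → ℂ
  let T : Matrix (Fin 2) (Fin n) ℂ →ₗ[ℂ] F × F :=
    { toFun := fun V => (π (V 0), π (V 1))
      map_add' := fun V U => Prod.ext (π.map_add (V 0) (U 0)) (π.map_add (V 1) (U 1))
      map_smul' := fun c V => Prod.ext (π.map_smul c (V 0)) (π.map_smul c (V 1)) }
  let K : Submodule ℂ (F × F) := D.map T
  let L₀ : K →L[ℂ] F := (ContinuousLinearMap.fst ℂ F F).comp K.subtypeL
  let L₁ : K →L[ℂ] F := (ContinuousLinearMap.snd ℂ F F).comp K.subtypeL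
  have hp : IsNondegeneratePencil L₀ L₁ := by
    rintro a b hab ⟨_, V, hV, rfl⟩ h0
    have h1 : π (a • V 0 + b • V 1) = 0 := by
      rw [map_add, map_smul, map_smul]; exact h0
    have h2 := h V hV a b hab ((hπ _).1 h1)
    refine Subtype.ext (Prod.ext ?_ ?_)
    · exact (hπ _).2 h2.1
    · exact (hπ _).2 h2.2
  have hK : ∀ d ∈ D, ∃ z : K, L₀ z = π (d 0) ∧ L₁ z = π (d 1) :=
    fun d hd => ⟨⟨T d, d, hd, rfl⟩, rfl, rfl⟩
  constructor
  · intro V hV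
    obtain ⟨⟨_, d, hd, rfl⟩, h0, h1⟩ := hp.exists_eq (p := π (V 0)) (q := π (V 1)) (by
      intro α
      obtain ⟨d, hd, hx⟩ := hV ![1, α]
      obtain ⟨z, hz0, hz1⟩ := hK d hd
      refine ⟨z, ?_⟩
      rw [vecMul_fin_two, vecMul_fin_two] at hx
      have := congrArg π hx
      simp only [Matrix.cons_val_zero, Matrix.cons_val_one, one_smul, map_add, map_smul] at this
      rw [hz0, hz1, this])
    refine ⟨d, hd, ?_, ?_⟩
    · exact (hπ _).1 (by rw [map_sub]; exact sub_eq_zero.2 h0.symm)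
    · exact (hπ _).1 (by rw [map_sub]; exact sub_eq_zero.2 h1.symm)
  · intro W hW
    obtain ⟨h0, h1⟩ := hp.eq_zero_of_conj (p := π (W 0)) (q := π (W 1)) (by
      intro α
      obtain ⟨d, hd, hx⟩ := hW ![1, α]
      obtain ⟨z, hz0, hz1⟩ := hK d hd
      refine ⟨z, ?_⟩
      rw [vecMul_fin_two, vecMul_fin_two] at hx
      have := congrArg π hx
      simp only [Pi.star_apply, Matrix.cons_val_zero, Matrix.cons_val_one, one_smul, map_add,
        map_smul, star_one] at this
      rw [hz0, hz1, ← this]; rfl)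
    exact ⟨(hπ _).1 h0, (hπ _).1 h1⟩

/-- How `D` and `E` meet the space `ℂ² ⊗ Y` of the matrices with rows in `Y`: either both contain
it, or they meet it in `ξ ⊗ Y` and `ξ̄ ⊗ Y`. -/
def HaveProductPart (D E : Submodule ℂ (Matrix (Fin 2) (Fin n) ℂ))
    (Y : Submodule ℂ (Fin n → ℂ)) : Prop :=
  (∀ V : Matrix (Fin 2) (Fin n) ℂ, V 0 ∈ Y → V 1 ∈ Y → V ∈ D ∧ V ∈ E) ∨
  ∃ ξ : Fin 2 → ℂ, ξ ≠ 0 ∧ ∀ V : Matrix (Fin 2) (Fin n) ℂ, V 0 ∈ Y → V 1 ∈ Y →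
    (V ∈ D ↔ ξ 0 • V 1 = ξ 1 • V 0) ∧ (V ∈ E ↔ star (ξ 0) • V 1 = star (ξ 1) • V 0)

/-- The condition `xᵀ V ∈ xᵀ D` for all `x` says that `V` is orthogonal to every product vector
orthogonal to `D`. Thus these product vectors span the orthogonal complement of `D`. -/
theorem HaveProductPart.mem_left {D E : Submodule ℂ (Matrix (Fin 2) (Fin n) ℂ)}
    {Y : Submodule ℂ (Fin n → ℂ)} (hE : HaveProductPart D E Y) (h : NoRankOneModulo D Y)
    {V : Matrix (Fin 2) (Fin n) ℂ}
    (hV : ∀ x, ∃ d ∈ D, Matrix.vecMul x V = Matrix.vecMul x d) : V ∈ D := by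
  obtain ⟨d₀, hd₀, h0, h1⟩ := h.spanning.1 V hV
  suffices hU : V - d₀ ∈ D by simpa using D.add_mem hU hd₀
  rcases hE with hE | ⟨ξ, hξ, hE⟩
  · exact (hE (V - d₀) h0 h1).1
  -- The remaining ambiguity is seen by the single vector `x` with `xᵀ ξ = 0`.
  obtain ⟨d, hd, hx⟩ := hV ![-ξ 1, ξ 0]
  rw [(hE (V - d₀) h0 h1).1]
  have hdd : d - d₀ ∈ D := D.sub_mem hd hd₀
  have hx' : -ξ 1 • (V - d₀) 0 + ξ 0 • (V - d₀) 1 = -ξ 1 • (d - d₀) 0 + ξ 0 • (d - d₀) 1 := by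
    rw [vecMul_fin_two, vecMul_fin_two] at hx
    simp only [Matrix.cons_val_zero, Matrix.cons_val_one] at hx
    change -ξ 1 • (V 0 - d₀ 0) + ξ 0 • (V 1 - d₀ 1) = -ξ 1 • (d 0 - d₀ 0) + ξ 0 • (d 1 - d₀ 1)
    linear_combination (norm := module) hx
  have hY := h _ hdd (-ξ 1) (ξ 0) (by
    by_contra! hc
    exact hξ (funext fun i => by fin_cases i <;> simp_all)) (by
      rw [← hx']; exact Y.add_mem (Y.smul_mem _ h0) (Y.smul_mem _ h1))
  have hz := (hE _ hY.1 hY.2).1.1 hdd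
  linear_combination (norm := module) hx' + hz

/-- The partial conjugates of the product vectors orthogonal to `D` leave no room outside `E`:
whatever they annihilate lies in `E`. -/
theorem HaveProductPart.mem_right {D E : Submodule ℂ (Matrix (Fin 2) (Fin n) ℂ)}
    {Y : Submodule ℂ (Fin n → ℂ)} (hE : HaveProductPart D E Y) (h : NoRankOneModulo D Y)
    {W : Matrix (Fin 2) (Fin n) ℂ}
    (hW : ∀ x, ∃ d ∈ D, Matrix.vecMul (star x) W = Matrix.vecMul x d) : W ∈ E := by
  obtain ⟨h0, h1⟩ := h.spanning.2 W hW
  rcases hE with hE | ⟨ξ, hξ, hE⟩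
  · exact (hE W h0 h1).2
  obtain ⟨d, hd, hx⟩ := hW ![-ξ 1, ξ 0]
  rw [(hE W h0 h1).2]
  rw [vecMul_fin_two, vecMul_fin_two] at hx
  simp only [Pi.star_apply, Matrix.cons_val_zero, Matrix.cons_val_one, star_neg] at hx
  have hY := h _ hd (-ξ 1) (ξ 0) (by
    by_contra! hc
    exact hξ (funext fun i => by fin_cases i <;> simp_all)) (by
      rw [← hx]; exact Y.add_mem (Y.smul_mem _ h0) (Y.smul_mem _ h1))
  have hz := (hE _ hY.1 hY.2).1.1 hd
  linear_combination (norm := module) hx + hz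

end Spanning

/-! ### The transposed form of a matrix of rank one modulo a row space -/

section PPT
variable {n : ℕ}

open Matrix in
/-- The identity behind the elimination of `η`: the copositive map of a partially conjugated and
rotated copy of `V = ξ ⊗ ζ + ξ' ⊗ (tζ + η)` is a combination of polarized maps, each with an entry
`V`, `ξ ⊗ η` or `ξ̄ ⊗ η`. -/
theorem two_smul_elementaryCopositiveMap_eq (ξ ξ' : Fin 2 → ℂ) (ζ η ω : Fin n → ℂ) (t μ : ℂ)
    (hμ : μ * star μ = 1) (ht : star t = μ * t) (hω : ω = t • ζ + η) :
    (2 : ℝ) • elementaryCopositiveMap (vecMulVec (star ξ) ζ + vecMulVec (star ξ') (μ • ω))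
      = polarizedMap (vecMulVec ξ ζ + vecMulVec ξ' ω) (vecMulVec ξ ζ)
        + polarizedMap (vecMulVec ξ ζ + vecMulVec ξ' ω) (vecMulVec ξ' ω)
        + (2 : ℝ) • polarizedMap (vecMulVec ξ η) (vecMulVec ξ' (star μ • ζ))
        - (2 : ℝ) • (polarizedMap (vecMulVec (star ξ) η) (vecMulVec (star ξ') ζ)
            ∘ₗ transposition 2) := by
  refine LinearMap.ext fun X => Matrix.ext fun k l => ?_
  simp only [elementaryCopositiveMap, LinearMap.comp_apply, LinearMap.add_apply,
    LinearMap.sub_apply, LinearMap.smul_apply, Matrix.add_apply, Matrix.sub_apply,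
    Matrix.smul_apply, elementaryMap_apply_apply, polarizedMap_apply_apply, transposition_apply,
    Matrix.transpose_apply, vecMulVec_apply, Fin.sum_univ_two, Pi.star_apply, Pi.smul_apply,
    Complex.real_smul, smul_eq_mul, star_add, star_mul', star_star, hω, Pi.add_apply, ht]
  push_cast
  linear_combination
    (2 * (star (ξ' 0) * X 0 0 * ξ' 0 + star (ξ' 0) * X 0 1 * ξ' 1
          + star (ξ' 1) * X 1 0 * ξ' 0 + star (ξ' 1) * X 1 1 * ξ' 1)
        * (μ * t * star (ζ k) + star (η k)) * (t * ζ l + η l)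
      + 2 * t * (star (ξ 0) * X 0 0 * ξ' 0 + star (ξ 0) * X 0 1 * ξ' 1
          + star (ξ 1) * X 1 0 * ξ' 0 + star (ξ 1) * X 1 1 * ξ' 1)
        * star (ζ k) * ζ l) * hμ

/-- If `V = ξ ⊗ ζ + ξ' ⊗ ω` with `ω = tζ + η` and `ξ ⊗ η` are null for the form of `f`, then
`ξ̄ ⊗ ζ + ξ̄' ⊗ μω` is null for the transposed form. When the latter form only has null vectors
`ξ̄ ⊗ y`, this forces `ω = 0`, so that `V` cannot have rank one modulo a row space containing
`η`. -/
theorem apply_elementaryCopositiveMap_eq_zero {f : MatrixMap 2 n →ₗ[ℝ] ℝ}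
    (hf : ∀ V, 0 ≤ f (elementaryMap V)) (hf' : ∀ V, 0 ≤ f (elementaryCopositiveMap V))
    {ξ ξ' : Fin 2 → ℂ} {ζ η ω : Fin n → ℂ} {t μ : ℂ}
    (hμ : μ * star μ = 1) (ht : star t = μ * t) (hω : ω = t • ζ + η)
    (hV : f (elementaryMap (Matrix.vecMulVec ξ ζ + Matrix.vecMulVec ξ' ω)) = 0)
    (hη : f (elementaryMap (Matrix.vecMulVec ξ η)) = 0) :
    f (elementaryCopositiveMap
      (Matrix.vecMulVec (star ξ) ζ + Matrix.vecMulVec (star ξ') (μ • ω))) = 0 := by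
  have hη' : f.comp (transposeDomain 2 n) (elementaryMap (Matrix.vecMulVec (star ξ) η)) = 0 := by
    change f (elementaryCopositiveMap _) = 0
    rw [elementaryCopositiveMap_vecMulVec_star, hη]
  have h4 : f (polarizedMap (Matrix.vecMulVec (star ξ) η) (Matrix.vecMulVec (star ξ') ζ)
      ∘ₗ transposition 2) = 0 :=
    apply_polarizedMap_eq_zero (f := f.comp (transposeDomain 2 n)) hf' hη' _
  have h := congrArg f (two_smul_elementaryCopositiveMap_eq ξ ξ' ζ η ω t μ hμ ht hω)
  rw [map_smul, map_sub, map_add, map_add, map_smul, map_smul,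
    apply_polarizedMap_eq_zero hf hV, apply_polarizedMap_eq_zero hf hV,
    apply_polarizedMap_eq_zero hf hη, h4] at h
  simpa using h

/-- The unit `μ` by which the second component has to be rotated in
`apply_elementaryCopositiveMap_eq_zero`. -/
theorem exists_unit_mul_eq_star (t : ℂ) : ∃ μ : ℂ, μ * star μ = 1 ∧ star t = μ * t := by
  by_cases ht : t = 0
  · exact ⟨1, by simp, by simp [ht]⟩
  · have ht' : star t ≠ 0 := star_ne_zero.2 ht
    refine ⟨star t / t, ?_, ?_⟩
    · rw [star_div₀, star_star]; field_simp
    · field_simp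

theorem exists_smul_eq_of_mul_eq_mul {y z : Fin n → ℂ} (hy : y ≠ 0)
    (h : ∀ k l, y k * z l = y l * z k) : ∃ c : ℂ, z = c • y := by
  obtain ⟨k, hk⟩ := Function.ne_iff.1 hy
  refine ⟨z k / y k, funext fun l => ?_⟩
  have hk' : y k ≠ 0 := hk
  have := h k l
  simp only [Pi.smul_apply, smul_eq_mul]
  field_simp
  linear_combination this

theorem eq_vecMulVec_add_vecMulVec (V : Matrix (Fin 2) (Fin n) ℂ) {x x' : Fin 2 → ℂ}
    (h : x 0 * x' 1 - x 1 * x' 0 ≠ 0) :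
    V = Matrix.vecMulVec x ((x 0 * x' 1 - x 1 * x' 0)⁻¹ • (x' 1 • V 0 - x' 0 • V 1))
      + Matrix.vecMulVec x' ((x 0 * x' 1 - x 1 * x' 0)⁻¹ • (x 0 • V 1 - x 1 • V 0)) := by
  ext i k
  simp only [Matrix.add_apply, Matrix.vecMulVec_apply, Pi.smul_apply, Pi.sub_apply, smul_eq_mul]
  fin_cases i <;> · simp only [Fin.zero_eta, Fin.mk_one]; field_simp; ring

end PPT

/-! ### Spaces of matrices of rank at most one -/

section RankOne
variable {n : ℕ}

open Matrix

@[simp]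
theorem vecMulVec_zero_right {m : ℕ} (x : Fin m → ℂ) : vecMulVec x (0 : Fin n → ℂ) = 0 :=
  Matrix.ext fun _ _ => mul_zero _

/-- Every matrix of `E` has rank at most one, expressed by the vanishing of the minors. -/
def HasRankAtMostOne (E : Submodule ℂ (Matrix (Fin 2) (Fin n) ℂ)) : Prop :=
  ∀ W ∈ E, ∀ k l, W 0 k * W 1 l = W 0 l * W 1 k

theorem minor_eq_row {W : Matrix (Fin 2) (Fin n) ℂ}
    (h : ∀ k l, W 0 k * W 1 l = W 0 l * W 1 k) (i j : Fin 2) (k l : Fin n) :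
    W i k * W j l = W i l * W j k := by
  fin_cases i <;> fin_cases j <;> simp only [Fin.zero_eta, Fin.mk_one]
  · ring
  · exact h k l
  · linear_combination h l k
  · ring

theorem exists_eq_vecMulVec_of_minor_eq {W : Matrix (Fin 2) (Fin n) ℂ} (hW : W ≠ 0)
    (h : ∀ k l, W 0 k * W 1 l = W 0 l * W 1 k) :
    ∃ x y, x ≠ 0 ∧ y ≠ 0 ∧ W = vecMulVec x y := by
  obtain ⟨i, k, hik⟩ : ∃ i k, W i k ≠ 0 := by
    by_contra! hc
    exact hW (Matrix.ext hc)
  refine ⟨fun j => W j k / W i k, W i, ?_, ?_, ?_⟩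
  · intro h0
    have := congrFun h0 i
    simp [hik] at this
  · intro h0
    exact hik (congrFun h0 k)
  · ext j l
    rw [vecMulVec_apply]
    field_simp
    linear_combination minor_eq_row h i j k l

theorem HasRankAtMostOne.polarized {E : Submodule ℂ (Matrix (Fin 2) (Fin n) ℂ)}
    (hE : HasRankAtMostOne E) {U W : Matrix (Fin 2) (Fin n) ℂ} (hU : U ∈ E) (hW : W ∈ E)
    (k l : Fin n) :
    U 0 k * W 1 l + W 0 k * U 1 l = U 0 l * W 1 k + W 0 l * U 1 k := by
  have h := hE _ (E.add_mem hU hW) k l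
  simp only [Matrix.add_apply] at h
  linear_combination h - hE _ hU k l - hE _ hW k l

/-- A space of matrices with two rows and rank at most one is either `ℂ² ⊗ η`, or contained in
`ξ ⊗ ℂⁿ` for some `ξ`. -/
theorem HasRankAtMostOne.classification {E : Submodule ℂ (Matrix (Fin 2) (Fin n) ℂ)}
    (hE : HasRankAtMostOne E) :
    (∃ η : Fin n → ℂ, ∀ W : Matrix (Fin 2) (Fin n) ℂ,
      W ∈ E ↔ W 0 ∈ Submodule.span ℂ {η} ∧ W 1 ∈ Submodule.span ℂ {η}) ∨
    ∃ ξ : Fin 2 → ℂ, ξ ≠ 0 ∧ ∀ W ∈ E, ξ 0 • W 1 = ξ 1 • W 0 := by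
  by_cases h0 : ∀ W ∈ E, W = 0
  · refine Or.inr ⟨![1, 0], fun h => one_ne_zero (congrFun h 0), fun W hW => ?_⟩
    rw [h0 W hW]; ext; simp
  push Not at h0
  obtain ⟨W₀, hW₀, hne⟩ := h0
  obtain ⟨ξ, y, hξ, hy, rfl⟩ := exists_eq_vecMulVec_of_minor_eq hne (hE _ hW₀)
  by_cases hall : ∀ W ∈ E, ξ 0 • W 1 = ξ 1 • W 0
  · exact Or.inr ⟨ξ, hξ, hall⟩
  push Not at hall
  obtain ⟨U, hU, hUne⟩ := hall
  left
  set u : Fin n → ℂ := ξ 0 • U 1 - ξ 1 • U 0 with hu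
  have hu0 : u ≠ 0 := sub_ne_zero.2 hUne
  have hyu : ∀ k l, y k * u l = y l * u k := by
    intro k l
    have := hE.polarized hW₀ hU k l
    simp only [vecMulVec_apply] at this
    simp only [hu, Pi.sub_apply, Pi.smul_apply, smul_eq_mul]
    linear_combination this
  obtain ⟨c, hc⟩ := exists_smul_eq_of_mul_eq_mul hy hyu
  have hrow : ∀ i, ∃ a : ℂ, U i = a • y := by
    intro i
    obtain ⟨a, ha⟩ := exists_smul_eq_of_mul_eq_mul (z := U i) hu0 (fun k l => by
      simp only [hu, Pi.sub_apply, Pi.smul_apply, smul_eq_mul]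
      linear_combination ξ 0 * minor_eq_row (hE _ hU) 1 i k l
        - ξ 1 * minor_eq_row (hE _ hU) 0 i k l)
    exact ⟨a * c, by rw [ha, hc, smul_smul]⟩
  choose a ha using hrow
  have hUv : U = vecMulVec a y := by
    ext i k
    rw [ha i]; rfl
  have hdet : ξ 0 * a 1 - ξ 1 * a 0 ≠ 0 := by
    intro h
    apply hu0
    rw [hu, ha, ha, smul_smul, smul_smul, ← sub_smul, h, zero_smul]
  have hmem : ∀ z : Fin 2 → ℂ, vecMulVec z y ∈ E := by
    intro z
    have e : vecMulVec z y
        = ((z 0 * a 1 - z 1 * a 0) / (ξ 0 * a 1 - ξ 1 * a 0)) • vecMulVec ξ y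
          + ((ξ 0 * z 1 - ξ 1 * z 0) / (ξ 0 * a 1 - ξ 1 * a 0)) • vecMulVec a y := by
      ext i k
      simp only [Matrix.add_apply, Matrix.smul_apply, vecMulVec_apply, smul_eq_mul]
      rw [div_mul_eq_mul_div, div_mul_eq_mul_div, ← add_div, eq_div_iff hdet]
      fin_cases i <;> · simp only [Fin.zero_eta, Fin.mk_one]; ring
    rw [e]
    exact E.add_mem (E.smul_mem _ hW₀) (E.smul_mem _ (hUv ▸ hU))
  refine ⟨y, fun W => ⟨fun hW => ⟨?_, ?_⟩, fun ⟨h0, h1⟩ => ?_⟩⟩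
  · obtain ⟨b, hb⟩ := exists_smul_eq_of_mul_eq_mul (z := W 0) hy (fun k l => by
      have := hE.polarized (hmem ![0, 1]) hW k l
      simp [vecMulVec_apply] at this
      linear_combination -this)
    exact Submodule.mem_span_singleton.2 ⟨b, hb.symm⟩
  · obtain ⟨b, hb⟩ := exists_smul_eq_of_mul_eq_mul (z := W 1) hy (fun k l => by
      have := hE.polarized (hmem ![1, 0]) hW k l
      simp [vecMulVec_apply] at this
      linear_combination this)
    exact Submodule.mem_span_singleton.2 ⟨b, hb.symm⟩
  · obtain ⟨b0, hb0⟩ := Submodule.mem_span_singleton.1 h0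
    obtain ⟨b1, hb1⟩ := Submodule.mem_span_singleton.1 h1
    have : W = vecMulVec ![b0, b1] y := by
      ext i k
      fin_cases i
      · exact (congrFun hb0 k).symm
      · exact (congrFun hb1 k).symm
    rw [this]
    exact hmem _

theorem exists_eq_vecMulVec_of_row_relation {V : Matrix (Fin 2) (Fin n) ℂ} {a b : ℂ}
    (hab : a ≠ 0 ∨ b ≠ 0) (h : a • V 0 + b • V 1 = 0) :
    ∃ x y, x ≠ 0 ∧ V = vecMulVec x y := by
  have hk : ∀ k, a * V 0 k + b * V 1 k = 0 := fun k => congrFun h k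
  by_cases ha : a = 0
  · have hb : b ≠ 0 := hab.resolve_left (not_not.2 ha)
    refine ⟨![1, 0], V 0, fun h => one_ne_zero (congrFun h 0), ?_⟩
    ext i k
    have := hk k
    simp only [ha, zero_mul, zero_add, mul_eq_zero, hb, false_or] at this
    fin_cases i <;> simp [vecMulVec_apply, this]
  · refine ⟨![-b / a, 1], V 1, fun h => one_ne_zero (congrFun h 1), ?_⟩
    ext i k
    fin_cases i
    · simp only [Fin.zero_eta, vecMulVec_apply, cons_val_zero]
      field_simp
      linear_combination hk k
    · simp [vecMulVec_apply]

theorem mem_of_row_space_singleton {D E : Submodule ℂ (Matrix (Fin 2) (Fin n) ℂ)}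
    (hDE : ∀ x y, vecMulVec x y ∈ D ↔ vecMulVec (star x) y ∈ E) {η : Fin n → ℂ}
    (hη : ∀ W : Matrix (Fin 2) (Fin n) ℂ,
      W ∈ E ↔ W 0 ∈ Submodule.span ℂ {η} ∧ W 1 ∈ Submodule.span ℂ {η})
    {V : Matrix (Fin 2) (Fin n) ℂ} (h0 : V 0 ∈ Submodule.span ℂ {η})
    (h1 : V 1 ∈ Submodule.span ℂ {η}) : V ∈ D := by
  obtain ⟨b0, hb0⟩ := Submodule.mem_span_singleton.1 h0
  obtain ⟨b1, hb1⟩ := Submodule.mem_span_singleton.1 h1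
  have : V = vecMulVec ![b0, b1] η := by
    ext i k
    fin_cases i
    · exact (congrFun hb0 k).symm
    · exact (congrFun hb1 k).symm
  rw [this, hDE, hη]
  exact ⟨Submodule.mem_span_singleton.2 ⟨star b0, rfl⟩,
    Submodule.mem_span_singleton.2 ⟨star b1, rfl⟩⟩

/-- When `E = ℂ² ⊗ η`, all rank one matrices of `D` lie in `ℂ² ⊗ η`, a subspace of `D`. -/
theorem noRankOneModulo_singleton {D E : Submodule ℂ (Matrix (Fin 2) (Fin n) ℂ)}
    (hDE : ∀ x y, vecMulVec x y ∈ D ↔ vecMulVec (star x) y ∈ E) {η : Fin n → ℂ}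
    (hη : ∀ W : Matrix (Fin 2) (Fin n) ℂ,
      W ∈ E ↔ W 0 ∈ Submodule.span ℂ {η} ∧ W 1 ∈ Submodule.span ℂ {η}) :
    NoRankOneModulo D (Submodule.span ℂ {η}) := by
  intro V hV a b hab hY
  set Y := Submodule.span ℂ {η}
  obtain ⟨P, hP0, hP1, hP⟩ : ∃ P : Matrix (Fin 2) (Fin n) ℂ, P 0 ∈ Y ∧ P 1 ∈ Y ∧
      a • P 0 + b • P 1 = a • V 0 + b • V 1 := by
    by_cases ha : a = 0
    · have hb : b ≠ 0 := hab.resolve_left (not_not.2 ha)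
      exact ⟨![0, b⁻¹ • (a • V 0 + b • V 1)], Y.zero_mem, Y.smul_mem _ hY, by simp [ha, hb]⟩
    · exact ⟨![a⁻¹ • (a • V 0 + b • V 1), 0], Y.smul_mem _ hY, Y.zero_mem, by simp [ha]⟩
  have hPD : P ∈ D := mem_of_row_space_singleton hDE hη hP0 hP1
  obtain ⟨x, y, hx, hxy⟩ := exists_eq_vecMulVec_of_row_relation (V := V - P) hab (by
    change a • (V 0 - P 0) + b • (V 1 - P 1) = 0
    linear_combination (norm := module) -hP)
  have hmem : V - P ∈ D := D.sub_mem hV hPD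
  rw [hxy, hDE, hη] at hmem
  have hy : y ∈ Y := by
    obtain ⟨i, hi⟩ := Function.ne_iff.1 hx
    have hi' : star (x i) ≠ 0 := star_ne_zero.2 hi
    have hrow : star (x i) • y ∈ Y := by
      fin_cases i
      · exact hmem.1
      · exact hmem.2
    have := Y.smul_mem (star (x i))⁻¹ hrow
    rwa [smul_smul, inv_mul_cancel₀ hi', one_smul] at this
  have hrows : ∀ i, V i = P i + x i • y := fun i => by
    have := congrFun hxy i
    change V i - P i = x i • y at this
    rw [← this]; abel
  rw [hrows, hrows]
  exact ⟨Y.add_mem hP0 (Y.smul_mem _ hy), Y.add_mem hP1 (Y.smul_mem _ hy)⟩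

/-- The structure of the null spaces `D` and `E` of a functional that is nonnegative on the
elementary maps of both kinds, when `E` consists of matrices of rank at most one. -/
theorem exists_row_space {f : MatrixMap 2 n →ₗ[ℝ] ℝ}
    (hf : ∀ V, 0 ≤ f (elementaryMap V)) (hf' : ∀ V, 0 ≤ f (elementaryCopositiveMap V))
    {D E : Submodule ℂ (Matrix (Fin 2) (Fin n) ℂ)}
    (hD : ∀ V, V ∈ D ↔ f (elementaryMap V) = 0)
    (hE : ∀ W, W ∈ E ↔ f (elementaryCopositiveMap W) = 0) (hr : HasRankAtMostOne E) :
    ∃ Y : Submodule ℂ (Fin n → ℂ), NoRankOneModulo D Y ∧ HaveProductPart D E Y := by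
  have hDE : ∀ x y, vecMulVec x y ∈ D ↔ vecMulVec (star x) y ∈ E := fun x y => by
    rw [hD, hE, elementaryCopositiveMap_vecMulVec_star]
  rcases hr.classification with ⟨η, hη⟩ | ⟨ξ₀, hξ₀, hcol⟩
  · exact ⟨Submodule.span ℂ {η}, noRankOneModulo_singleton hDE hη, Or.inl fun V h0 h1 =>
      ⟨mem_of_row_space_singleton hDE hη h0 h1, (hη V).2 ⟨h0, h1⟩⟩⟩
  obtain ⟨ξ, rfl⟩ : ∃ ξ, ξ₀ = star ξ := ⟨star ξ₀, (star_star _).symm⟩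
  have hξ : ξ ≠ 0 := star_ne_zero.1 hξ₀
  obtain ⟨ξ', hdet⟩ : ∃ ξ' : Fin 2 → ℂ, ξ 0 * ξ' 1 - ξ 1 * ξ' 0 ≠ 0 := by
    by_cases h0 : ξ 0 = 0
    · have h1 : ξ 1 ≠ 0 := fun h1 => hξ (funext fun i => by fin_cases i <;> simp [h0, h1])
      exact ⟨![1, 0], by simpa using h1⟩
    · exact ⟨![0, 1], by simpa using h0⟩
  have hdet' : star (ξ 0) * star (ξ' 1) - star (ξ 1) * star (ξ' 0) ≠ 0 := by
    rw [← star_mul', ← star_mul', ← star_sub]; exact star_ne_zero.2 hdet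
  let Y : Submodule ℂ (Fin n → ℂ) :=
    { carrier := {y | vecMulVec ξ y ∈ D}
      add_mem' := fun {y z} hy hz => by
        change vecMulVec ξ (y + z) ∈ D
        rw [vecMulVec_add]; exact D.add_mem hy hz
      zero_mem' := by
        change vecMulVec ξ 0 ∈ D
        rw [vecMulVec_zero_right]; exact D.zero_mem
      smul_mem' := fun c y hy => by
        change vecMulVec ξ (c • y) ∈ D
        rw [vecMulVec_smul]; exact D.smul_mem c hy }
  have hY : ∀ y, y ∈ Y ↔ vecMulVec ξ y ∈ D := fun y => Iff.rfl
  have hE0 : ∀ ζ ω, vecMulVec (star ξ) ζ + vecMulVec (star ξ') ω ∈ E → ω = 0 := by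
    intro ζ ω h
    funext k
    have := congrFun (hcol _ h) k
    simp only [Pi.smul_apply, Matrix.add_apply, vecMulVec_apply, Pi.star_apply,
      smul_eq_mul] at this
    have h2 : (star (ξ 0) * star (ξ' 1) - star (ξ 1) * star (ξ' 0)) * ω k = 0 := by
      linear_combination this
    exact (mul_eq_zero.1 h2).resolve_left hdet'
  have hD0 : ∀ ζ ω, vecMulVec ξ ζ + vecMulVec ξ' ω ∈ D → ζ ∈ Y → ω = 0 := by
    intro ζ ω h hζ
    have h1 : vecMulVec ξ' ω ∈ D := by simpa using D.sub_mem h ((hY _).1 hζ)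
    rw [hDE] at h1
    exact hE0 0 ω (by simpa using h1)
  have hbasis : ∀ V : Matrix (Fin 2) (Fin n) ℂ, ∃ ζ ω, V = vecMulVec ξ ζ + vecMulVec ξ' ω :=
    fun V => ⟨_, _, eq_vecMulVec_add_vecMulVec V hdet⟩
  refine ⟨Y, ?_, Or.inr ⟨ξ, hξ, fun V h0 h1 => ⟨⟨fun hV => ?_, fun hV => ?_⟩,
    ⟨fun hV => hcol V hV, fun hV => ?_⟩⟩⟩⟩
  · intro V hV a b hab hmem
    suffices h : ∃ ζ ω, V = vecMulVec ξ ζ + vecMulVec ξ' ω ∧ ζ ∈ Y ∧ ω ∈ Y by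
      obtain ⟨ζ, ω, rfl, hζ, hω⟩ := h
      exact ⟨Y.add_mem (Y.smul_mem _ hζ) (Y.smul_mem _ hω),
        Y.add_mem (Y.smul_mem _ hζ) (Y.smul_mem _ hω)⟩
    obtain ⟨ζ, ω, rfl⟩ := hbasis V
    set s := a * ξ 0 + b * ξ 1 with hs
    set r := a * ξ' 0 + b * ξ' 1 with hr'
    have hsr : s • ζ + r • ω ∈ Y := by
      convert hmem using 1
      ext k
      simp only [Pi.add_apply, Pi.smul_apply, Matrix.add_apply, vecMulVec_apply, smul_eq_mul, hs,
        hr']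
      ring
    refine ⟨ζ, ω, rfl, ?_⟩
    by_cases hr0 : r = 0
    · have hs0 : s ≠ 0 := by
        intro hs0
        have ha : a * (ξ 0 * ξ' 1 - ξ 1 * ξ' 0) = 0 := by
          linear_combination ξ' 1 * (hs ▸ hs0 : a * ξ 0 + b * ξ 1 = 0)
            - ξ 1 * (hr' ▸ hr0 : a * ξ' 0 + b * ξ' 1 = 0)
        have hb : b * (ξ 0 * ξ' 1 - ξ 1 * ξ' 0) = 0 := by
          linear_combination ξ 0 * (hr' ▸ hr0 : a * ξ' 0 + b * ξ' 1 = 0)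
            - ξ' 0 * (hs ▸ hs0 : a * ξ 0 + b * ξ 1 = 0)
        have ha' := (mul_eq_zero.1 ha).resolve_right hdet
        have hb' := (mul_eq_zero.1 hb).resolve_right hdet
        exact hab.elim (fun h => h ha') (fun h => h hb')
      have hζ : ζ ∈ Y := by
        rw [hr0, zero_smul, add_zero] at hsr
        have := Y.smul_mem s⁻¹ hsr
        rwa [smul_smul, inv_mul_cancel₀ hs0, one_smul] at this
      exact ⟨hζ, hD0 ζ ω hV hζ ▸ Y.zero_mem⟩
    · -- Otherwise `ω` is a multiple of `ζ` up to an element of `Y`.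
      have hη : r⁻¹ • (s • ζ + r • ω) ∈ Y := Y.smul_mem _ hsr
      obtain ⟨μ, hμ, ht⟩ := exists_unit_mul_eq_star (-(s / r))
      have hωeq : ω = (-(s / r)) • ζ + r⁻¹ • (s • ζ + r • ω) := by
        rw [smul_add, smul_smul, smul_smul, inv_mul_cancel₀ hr0, div_eq_inv_mul]; module
      have hnull := apply_elementaryCopositiveMap_eq_zero hf hf' hμ ht hωeq
        ((hD _).1 hV) ((hD _).1 ((hY _).1 hη))
      have hμω : μ • ω = 0 := hE0 _ _ ((hE _).2 hnull)
      have hω0 : ω = 0 := (smul_eq_zero.1 hμω).resolve_left (by rintro rfl; simp at hμ)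
      refine ⟨?_, hω0 ▸ Y.zero_mem⟩
      rw [hY]
      simpa [hω0] using hV
  · obtain ⟨ζ, ω, hVe⟩ : ∃ ζ ω, V = vecMulVec ξ ζ + vecMulVec ξ' ω ∧ ζ ∈ Y :=
      ⟨_, _, eq_vecMulVec_add_vecMulVec V hdet,
        Y.smul_mem _ (Y.sub_mem (Y.smul_mem _ h0) (Y.smul_mem _ h1))⟩
    obtain ⟨rfl, hζ⟩ := hVe
    rw [hD0 ζ ω hV hζ]
    ext k
    simp [vecMulVec_apply]
    ring
  · rw [eq_vecMulVec_add_vecMulVec V hdet, sub_eq_zero.2 hV, smul_zero, vecMulVec_zero_right,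
      add_zero]
    exact (hY _).1 (Y.smul_mem _ (Y.sub_mem (Y.smul_mem _ h0) (Y.smul_mem _ h1)))
  · rw [eq_vecMulVec_add_vecMulVec V (x := star ξ) (x' := star ξ') (by simpa using hdet')]
    simp only [Pi.star_apply]
    rw [sub_eq_zero.2 hV, smul_zero, vecMulVec_zero_right, add_zero, ← hDE]
    exact (hY _).1 (Y.smul_mem _ (Y.sub_mem (Y.smul_mem _ h0) (Y.smul_mem _ h1)))

end RankOne

/-! ### Separable states -/

section Pairing
variable {m n : ℕ}

open Matrix

theorem dualPairing_add_left (A B : Matrix (Fin n × Fin m) (Fin n × Fin m) ℂ)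
    (φ : MatrixMap m n) : dualPairing (A + B) φ = dualPairing A φ + dualPairing B φ := by
  simp only [dualPairing, ← Finset.sum_add_distrib, ← trace_add, ← Matrix.mul_add,
    ← transpose_add]
  rfl

theorem dualPairing_sum_left {ι : Type*} (s : Finset ι)
    (A : ι → Matrix (Fin n × Fin m) (Fin n × Fin m) ℂ) (φ : MatrixMap m n) :
    dualPairing (∑ i ∈ s, A i) φ = ∑ i ∈ s, dualPairing (A i) φ :=
  map_sum (AddMonoidHom.mk' (fun A => dualPairing A φ)
    (fun A B => dualPairing_add_left A B φ)) A s

/-- The pairing with a fixed matrix, as a complex linear functional. -/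
def dualPairingRight (A : Matrix (Fin n × Fin m) (Fin n × Fin m) ℂ) :
    MatrixMap m n →ₗ[ℂ] ℂ where
  toFun := dualPairing A
  map_add' φ ψ := by
    simp only [dualPairing, LinearMap.add_apply, Matrix.add_mul, trace_add,
      Finset.sum_add_distrib]
  map_smul' c φ := by
    simp only [dualPairing, LinearMap.smul_apply, Matrix.smul_mul, trace_smul, Finset.smul_sum,
      RingHom.id_apply]

theorem dualPairingRight_apply (A : Matrix (Fin n × Fin m) (Fin n × Fin m) ℂ)
    (φ : MatrixMap m n) : dualPairingRight A φ = dualPairing A φ := rfl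

open scoped MatrixOrder in
theorem trace_mul_nonneg_of_posSemidef {P Q : Matrix (Fin n) (Fin n) ℂ} (hP : P.PosSemidef)
    (hQ : Q.PosSemidef) : 0 ≤ (P * Q).trace := by
  obtain ⟨B, hB⟩ := CStarAlgebra.nonneg_iff_eq_star_mul_self.mp hQ.nonneg
  rw [hB, star_eq_conjTranspose, ← Matrix.mul_assoc, trace_mul_comm, ← Matrix.mul_assoc]
  exact (hP.mul_mul_conjTranspose_same B).trace_nonneg

theorem dualPairing_nonneg {A : Matrix (Fin n × Fin m) (Fin n × Fin m) ℂ}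
    (hA : A ∈ separableCone m n) {φ : MatrixMap m n} (hφ : φ ∈ decomposableCone m n) :
    0 ≤ dualPairing A φ := by
  obtain ⟨r, y, x, hy, hx, rfl⟩ := hA
  obtain ⟨V, W, rfl⟩ := exists_eq_sum_of_mem_decomposableCone hφ
  rw [dualPairing_sum_left]
  refine Finset.sum_nonneg fun s _ => ?_
  rw [← dualPairingRight_apply, map_add, map_sum, map_sum]
  refine add_nonneg (Finset.sum_nonneg fun r _ => ?_) (Finset.sum_nonneg fun r _ => ?_)
  · rw [dualPairingRight_apply, dualPairing_kronecker]
    exact trace_mul_nonneg_of_posSemidef ((hx s).conjTranspose_mul_mul_same _) (hy s).transpose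
  · rw [dualPairingRight_apply, dualPairing_kronecker]
    exact trace_mul_nonneg_of_posSemidef ((hx s).transpose.conjTranspose_mul_mul_same _)
      (hy s).transpose

theorem IsExposedBySeparableStates.isExposedInCone {F : Set (MatrixMap m n)}
    (h : IsExposedBySeparableStates F) : IsExposedInCone (decomposableCone m n) F := by
  obtain ⟨A, hA, rfl⟩ := h
  refine ⟨Complex.reLm ∘ₗ (dualPairingRight A).restrictScalars ℝ, fun φ hφ => ?_, ?_⟩
  · exact (Complex.nonneg_iff.1 (dualPairing_nonneg hA hφ)).1
  · ext φ
    refine and_congr_right fun hφ => ⟨fun h0 => ?_, fun h0 => ?_⟩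
    · change (dualPairing A φ).re = 0
      rw [h0, Complex.zero_re]
    · exact Complex.ext h0 (Complex.nonneg_iff.1 (dualPairing_nonneg hA hφ)).2.symm

/-- The separable state (up to normalization) of the product vector with factors `x` and `y`, with
conjugations chosen so that its pairing with `φ_V` is `|xᵀ V y|²`. -/
def productState (x : Fin m → ℂ) (y : Fin n → ℂ) :
    Matrix (Fin n × Fin m) (Fin n × Fin m) ℂ :=
  vecMulVec (star y) y ⊗ₖ vecMulVec (star x) x

theorem dualPairing_productState_elementaryMap (x : Fin m → ℂ) (y : Fin n → ℂ)
    (V : Matrix (Fin m) (Fin n) ℂ) :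
    dualPairing (productState x y) (elementaryMap V)
      = star (x ⬝ᵥ V *ᵥ y) * (x ⬝ᵥ V *ᵥ y) := by
  rw [productState, dualPairing_kronecker]
  change (Vᴴ * vecMulVec (star x) x * V * (vecMulVec (star y) y)ᵀ).trace = _
  have h1 : Vᴴ * vecMulVec (star x) x * V = vecMulVec (star (x ᵥ* V)) (x ᵥ* V) := by
    rw [mul_vecMulVec, vecMulVec_mul, star_vecMul]
  have h2 : (vecMulVec (star y) y)ᵀ = vecMulVec y (star y) := by
    ext i j; simp [vecMulVec_apply, mul_comm]
  rw [h1, h2, vecMulVec_mul_vecMulVec, vecMulVec_smul, trace_smul, trace_vecMulVec,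
    dotProduct_mulVec,
    star_dotProduct_star, smul_eq_mul, mul_comm]
  congr 1
  rw [dotProduct_comm]

theorem dualPairing_productState_elementaryCopositiveMap (x : Fin m → ℂ) (y : Fin n → ℂ)
    (V : Matrix (Fin m) (Fin n) ℂ) :
    dualPairing (productState x y) (elementaryCopositiveMap V)
      = star (star x ⬝ᵥ V *ᵥ y) * (star x ⬝ᵥ V *ᵥ y) := by
  rw [← dualPairing_productState_elementaryMap, productState, productState, dualPairing_kronecker,
    dualPairing_kronecker, elementaryCopositiveMap, LinearMap.comp_apply, transposition_apply]
  congr 3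
  ext i j
  simp [vecMulVec_apply, mul_comm]

theorem sum_productState_mem_separableCone {ι : Type*} (t : Finset ι) (x : ι → Fin m → ℂ)
    (y : ι → Fin n → ℂ) : ∑ i ∈ t, productState (x i) (y i) ∈ separableCone m n := by
  have hpsd : ∀ {k : ℕ} (z : Fin k → ℂ), (vecMulVec (star z) z).PosSemidef := fun z => by
    simpa using posSemidef_vecMulVec_self_star (star z)
  refine ⟨t.card, fun s => vecMulVec (star (y (t.equivFin.symm s))) (y (t.equivFin.symm s)),
    fun s => vecMulVec (star (x (t.equivFin.symm s))) (x (t.equivFin.symm s)),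
    fun _ => hpsd _, fun _ => hpsd _, ?_⟩
  rw [← Finset.sum_coe_sort, ← Equiv.sum_comp t.equivFin.symm]
  rfl

/-- A vector that is orthogonal to the annihilator of a subspace belongs to the subspace. -/
theorem exists_vecMul_eq {D : Submodule ℂ (Matrix (Fin m) (Fin n) ℂ)} {x : Fin m → ℂ}
    {z : Fin n → ℂ} (h : ∀ y, (∀ d ∈ D, x ⬝ᵥ d *ᵥ y = 0) → z ⬝ᵥ y = 0) :
    ∃ d ∈ D, z = x ᵥ* d := by
  let S : Submodule ℂ (Fin n → ℂ) := D.map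
    { toFun := fun d => x ᵥ* d
      map_add' := fun d e => vecMul_add d e x
      map_smul' := fun c d => by rw [vecMul_smul, RingHom.id_apply] }
  suffices hz : z ∈ S by
    obtain ⟨d, hd, hdz⟩ := hz
    exact ⟨d, hd, hdz.symm⟩
  by_contra hz
  obtain ⟨ℓ, hℓ, hℓS⟩ := S.exists_dual_map_eq_bot_of_notMem hz inferInstance
  obtain ⟨y, rfl⟩ := (dotProductEquiv ℂ (Fin n)).surjective ℓ
  refine hℓ ?_
  rw [dotProductEquiv_apply_apply, dotProduct_comm]
  refine h y fun d hd => ?_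
  have hmem : dotProductEquiv ℂ (Fin n) y (x ᵥ* d) ∈ S.map (dotProductEquiv ℂ (Fin n) y) :=
    ⟨_, ⟨d, hd, rfl⟩, rfl⟩
  rw [hℓS, Submodule.mem_bot, dotProductEquiv_apply_apply, dotProduct_comm] at hmem
  rw [dotProduct_mulVec, hmem]

/-- Finitely many of the product vectors orthogonal to `D` already detect membership in the two
subspaces that all of them detect. -/
theorem exists_finset_productVectors (D : Submodule ℂ (Matrix (Fin m) (Fin n) ℂ)) :
    ∃ t : Finset ((Fin m → ℂ) × (Fin n → ℂ)),
      (∀ p ∈ t, ∀ d ∈ D, p.1 ⬝ᵥ d *ᵥ p.2 = 0) ∧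
      (∀ V, (∀ p ∈ t, p.1 ⬝ᵥ V *ᵥ p.2 = 0) → ∀ x, ∃ d ∈ D, x ᵥ* V = x ᵥ* d) ∧
      (∀ W, (∀ p ∈ t, star p.1 ⬝ᵥ W *ᵥ p.2 = 0) → ∀ x, ∃ d ∈ D, star x ᵥ* W = x ᵥ* d) := by
  classical
  let ι := {p : (Fin m → ℂ) × (Fin n → ℂ) // ∀ d ∈ D, p.1 ⬝ᵥ d *ᵥ p.2 = 0}
  let N : ι → Submodule ℂ (Matrix (Fin m) (Fin n) ℂ × Matrix (Fin m) (Fin n) ℂ) := fun p =>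
    { carrier := {z | p.1.1 ⬝ᵥ z.1 *ᵥ p.1.2 = 0 ∧ star p.1.1 ⬝ᵥ z.2 *ᵥ p.1.2 = 0}
      add_mem' := fun {z w} hz hw => by
        constructor
        · rw [Prod.fst_add, add_mulVec, dotProduct_add, hz.1, hw.1, add_zero]
        · rw [Prod.snd_add, add_mulVec, dotProduct_add, hz.2, hw.2, add_zero]
      zero_mem' := by constructor <;> simp
      smul_mem' := fun c z hz => by
        constructor
        · rw [Prod.smul_fst, smul_mulVec, dotProduct_smul, hz.1, smul_zero]
        · rw [Prod.smul_snd, smul_mulVec, dotProduct_smul, hz.2, smul_zero] }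
  obtain ⟨t, ht⟩ := Finset.exists_inf_le N
  have hall : ∀ z : Matrix (Fin m) (Fin n) ℂ × Matrix (Fin m) (Fin n) ℂ,
      (∀ p ∈ t, z ∈ N p) → ∀ p, z ∈ N p := fun z hz p =>
    ht p (by simpa [Submodule.mem_finsetInf] using hz)
  refine ⟨t.image Subtype.val, ?_, fun V hV x => ?_, fun W hW x => ?_⟩
  · intro p hp
    obtain ⟨q, -, rfl⟩ := Finset.mem_image.1 hp
    exact q.2
  · refine exists_vecMul_eq fun y hy => ?_
    rw [← dotProduct_mulVec]
    exact (hall (V, 0) (fun p hp =>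
      ⟨hV p.1 (Finset.mem_image_of_mem _ hp), by simp⟩) ⟨(x, y), hy⟩).1
  · refine exists_vecMul_eq fun y hy => ?_
    rw [← dotProduct_mulVec]
    exact (hall (0, W) (fun p hp =>
      ⟨by simp, hW p.1 (Finset.mem_image_of_mem _ hp)⟩) ⟨(x, y), hy⟩).2

theorem summands_eq_zero_of_add_eq_zero {ι κ : Type*} {s : Finset ι} {t : Finset κ} {a : ι → ℂ}
    {b : κ → ℂ} (ha : ∀ i ∈ s, 0 ≤ a i) (hb : ∀ i ∈ t, 0 ≤ b i)
    (h : ∑ i ∈ s, a i + ∑ i ∈ t, b i = 0) : (∀ i ∈ s, a i = 0) ∧ ∀ i ∈ t, b i = 0 := by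
  have h' := (add_eq_zero_iff_of_nonneg (Finset.sum_nonneg ha) (Finset.sum_nonneg hb)).1 h
  exact ⟨(Finset.sum_eq_zero_iff_of_nonneg ha).1 h'.1,
    (Finset.sum_eq_zero_iff_of_nonneg hb).1 h'.2⟩

/-- The exposing separable state is a finite sum of product states orthogonal to `D`. Its form
vanishes only on `D`, and its transposed form only on `E`, whose elementary copositive maps belong
to `cpFace D`. -/
theorem isExposedBySeparableStates_of_isExposedInCone
    {D : Submodule ℂ (Matrix (Fin 2) (Fin n) ℂ)}
    (hD : IsConvexFace (decomposableCone 2 n) (cpFace D))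
    (h : IsExposedInCone (decomposableCone 2 n) (cpFace D)) :
    IsExposedBySeparableStates (cpFace D) := by
  obtain ⟨f, hf0, hF⟩ := h
  have hmem : ∀ φ ∈ decomposableCone 2 n, (φ ∈ cpFace D ↔ f φ = 0) := fun φ hφ => by
    rw [hF]; exact and_iff_right hφ
  have hf : ∀ V, 0 ≤ f (elementaryMap V) := fun V => hf0 _ (elementaryMap_mem_decomposableCone V)
  have hf' : ∀ V, 0 ≤ f (elementaryCopositiveMap V) := fun V =>
    hf0 _ (elementaryCopositiveMap_mem_decomposableCone V)
  let E := nullSpace (f.comp (transposeDomain 2 n)) hf'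
  have hE : ∀ W, W ∈ E ↔ f (elementaryCopositiveMap W) = 0 := fun W => Iff.rfl
  have hEF : ∀ W, W ∈ E ↔ elementaryCopositiveMap W ∈ cpFace D := fun W => by
    rw [hE, hmem _ (elementaryCopositiveMap_mem_decomposableCone W)]
  obtain ⟨Y, hY, hprod⟩ := exists_row_space hf hf' (D := D) (E := E)
    (fun V => by
      rw [← elementaryMap_mem_cpFace_iff, hmem _ (elementaryMap_mem_decomposableCone V)]) hE
    (fun W hW => minor_eq_of_elementaryCopositiveMap_mem_cpFace ((hEF W).1 hW))
  obtain ⟨t, htD, htV, htW⟩ := exists_finset_productVectors D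
  have hV : ∀ V, (∀ p ∈ t, p.1 ⬝ᵥ V *ᵥ p.2 = 0) → V ∈ D := fun V h =>
    hprod.mem_left hY (htV V h)
  have hW : ∀ W, (∀ p ∈ t, star p.1 ⬝ᵥ W *ᵥ p.2 = 0) → W ∈ E := fun W h =>
    hprod.mem_right hY (htW W h)
  refine ⟨∑ p ∈ t, productState p.1 p.2, sum_productState_mem_separableCone t _ _, ?_⟩
  have hpV : ∀ V, dualPairing (∑ p ∈ t, productState p.1 p.2) (elementaryMap V)
      = ∑ p ∈ t, star (p.1 ⬝ᵥ V *ᵥ p.2) * (p.1 ⬝ᵥ V *ᵥ p.2) := fun V => by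
    rw [dualPairing_sum_left]
    exact Finset.sum_congr rfl fun p _ => dualPairing_productState_elementaryMap _ _ _
  have hpW : ∀ W, dualPairing (∑ p ∈ t, productState p.1 p.2) (elementaryCopositiveMap W)
      = ∑ p ∈ t, star (star p.1 ⬝ᵥ W *ᵥ p.2) * (star p.1 ⬝ᵥ W *ᵥ p.2) := fun W => by
    rw [dualPairing_sum_left]
    exact Finset.sum_congr rfl fun p _ => dualPairing_productState_elementaryCopositiveMap _ _ _
  ext φ
  constructor
  · intro hφ
    refine ⟨hD.2.subset hφ, ?_⟩
    obtain ⟨S, hS, rfl⟩ := hφ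
    rw [← dualPairingRight_apply, map_sum]
    refine Finset.sum_eq_zero fun V hVS => ?_
    rw [dualPairingRight_apply, hpV]
    exact Finset.sum_eq_zero fun p hp => by rw [htD p hp V (hS hVS), mul_zero]
  · rintro ⟨hφ, h0⟩
    obtain ⟨V, W, rfl⟩ := exists_eq_sum_of_mem_decomposableCone hφ
    rw [← dualPairingRight_apply, map_add, map_sum, map_sum] at h0
    simp only [dualPairingRight_apply, hpV, hpW] at h0
    obtain ⟨hV0, hW0⟩ := summands_eq_zero_of_add_eq_zero
      (fun _ _ => Finset.sum_nonneg fun _ _ => star_mul_self_nonneg _)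
      (fun _ _ => Finset.sum_nonneg fun _ _ => star_mul_self_nonneg _) h0
    refine add_mem_cpFace hD.1 (sum_mem_cpFace hD.1 _ fun r hr => ?_)
      (sum_mem_cpFace hD.1 _ fun r hr => ?_)
    · refine elementaryMap_mem_cpFace (hV _ fun p hp => ?_)
      have := (Finset.sum_eq_zero_iff_of_nonneg fun _ _ => star_mul_self_nonneg _).1 (hV0 r hr) p hp
      exact (mul_eq_zero.1 this).elim star_eq_zero.1 id
    · refine (hEF _).1 (hW _ fun p hp => ?_)
      have := (Finset.sum_eq_zero_iff_of_nonneg fun _ _ => star_mul_self_nonneg _).1 (hW0 r hr) p hp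
      exact (mul_eq_zero.1 this).elim star_eq_zero.1 id

end Pairing

theorem mainTheorem3 (n : ℕ) (D : Submodule ℂ (Matrix (Fin 2) (Fin n) ℂ))
    (hD : IsConvexFace (decomposableCone 2 n) (cpFace D)) :
    IsExposedInCone (decomposableCone 2 n) (cpFace D) ↔
      IsExposedBySeparableStates (cpFace D) :=
  ⟨isExposedBySeparableStates_of_isExposedInCone hD,
    IsExposedBySeparableStates.isExposedInCone⟩
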